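/- Let $\mathbb{P}=\{1,2,3,\dots\}$. Let $S_{\mathbb{Z}}$ be the group of permutations of $\mathbb{Z}$ fixing all but finitely many points, $S_\infty$ its subgroup of permutations with support in $\mathbb{P}$, and $S_n\subset S_\infty$ the subgroup of permutations with support in $\{1,\dots,n\}$. Let $s_i=(i,i+1)$, $\mathrm{Inv}(w)=\{(i,j)\in\mathbb{Z}^2: i<j,\ w(i)>w(j)\}$ and $\ell(w)=|\mathrm{Inv}(w)|$. On $\mathbb{Z}[x_1,x_2,\dots]$ let $\partial_i f=(f-s_if)/(x_i-x_{i+1})$, where $s_i$ exchanges $x_i$ and $x_{i+1}$; for $w\in S_\infty$ let $\partial_w=\partial_{i_1}\cdots\partial_{i_k}$ for any reduced word $w=s_{i_1}\cdots s_{i_k}$, and for $v\in S_n$ let $\mathfrak{S}_v=\partial_{v^{-1}w_n}(x_1^{n-1}x_2^{n-2}\cdots x_{n-1})$ be the Schubert polynomial, where $w_n=n\cdots 321$ (this does not depend on $n$). Let $\Theta:\mathbb{Z}\to\mathbb{Z}$, $\Theta(i)=i-(-1)^i$, and let $\mathcal{F}_\infty\subset\mathcal{F}_{\mathbb{Z}}$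 be the $S_\infty$- and $S_{\mathbb{Z}}$-conjugacy classes of $\Theta$. For $z\in\mathcal{F}_{\mathbb{Z}}$ let $\mathcal{A}_{\mathrm{FPF}}(z)$ be the set of $w\in S_{\mathbb{Z}}$ of minimal length with $z=w^{-1}\Theta w$. Define $\hat{\mathfrak{S}}^{\mathrm{FPF}}_z=\sum_{w\in\mathcal{A}_{\mathrm{FPF}}(z)}\mathfrak{S}_w$ for $z\in\mathcal{F}_\infty$, and $\hat{\mathfrak{S}}^{\mathrm{FPF}}_z=0$ for $z\in\mathcal{F}_{\mathbb{Z}}\setminus\mathcal{F}_\infty$. For $z\in\mathcal{F}_{\mathbb{Z}}$ let $\hat\ell_{\mathrm{FPF}}(z)=\tfrac12\,|\{(i,j)\in\mathrm{Inv}(z): j\ne z(i)\}|$. The Bruhat order $\le$ on $\mathcal{F}_{\mathbb{Z}}$ is the weakest partial order with $z<tzt$ whenever $t$ is a transposition of $\mathbb{Z}$ with $\hat\ell_{\mathrm{FPF}}(z)<\hat\ell_{\mathrm{FPF}}(tzt)$; write $y\lessdot_{\mathcal{F}}z$ if $\{w\in\mathcal{F}_{\mathbb{Z}}: y\le w<z\}=\{y\}$.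 For $y\in\mathcal{F}_{\mathbb{Z}}$ and $r\in\mathbb{Z}$ put $$\hat\Psi^+(y,r)=\{z\in\mathcal{F}_{\mathbb{Z}}: y\lessdot_{\mathcal{F}}z \text{ and } z=(r,j)\,y\,(r,j)\text{ for an integer } j>r\},$$ $$\hat\Psi^-(y,r)=\{z\in\mathcal{F}_{\mathbb{Z}}: y\lessdot_{\mathcal{F}}z \text{ and } z=(i,r)\,y\,(i,r)\text{ for an integer } i<r\}.$$ **Theorem.** Let $y\in\mathcal{F}_\infty$ and let $p,q\in\mathbb{P}$ with $p\le q=y(p)$. Then $\hat\Psi^+(y,q)$ and $\hat\Psi^-(y,p)$ are finite, and $$(x_p+x_q)\,\hat{\mathfrak{S}}^{\mathrm{FPF}}_y=\sum_{z\in\hat\Psi^+(y,q)}\hat{\mathfrak{S}}^{\mathrm{FPF}}_z-\sum_{z\in\hat\Psi^-(y,p)}\hat{\mathfrak{S}}^{\mathrm{FPF}}_z .$$ -/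

import Mathlib

namespace FPFSchubert

/-! ### Permutations of the integers -/

/-- The group `S_ℤ` of permutations of `ℤ` which fix all but finitely many points. -/
def SZ : Subgroup (Equiv.Perm ℤ) where
  carrier := {w | {x : ℤ | w x ≠ x}.Finite}
  one_mem' := by simp
  mul_mem' := by
    intro a b ha hb
    refine (ha.union hb).subset ?_
    intro x hx
    by_contra h
    simp only [Set.mem_union, Set.mem_ofPred_eq, not_or, not_not] at h
    exact hx (by simp [Equiv.Perm.mul_apply, h.1, h.2])
  inv_mem' := by
    intro a ha
    refine Set.Finite.subset ha ?_
    intro x hx h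
    exact hx (by rw [Equiv.Perm.inv_eq_iff_eq]; exact h.symm)

/-- The subgroup `S_∞` of `S_ℤ` of permutations with support in `{1, 2, 3, …}`. -/
def SInf : Subgroup (Equiv.Perm ℤ) where
  carrier := {w | w ∈ SZ ∧ ∀ x : ℤ, w x ≠ x → 1 ≤ x}
  one_mem' := ⟨SZ.one_mem, by simp⟩
  mul_mem' := by
    rintro a b ⟨ha, ha'⟩ ⟨hb, hb'⟩
    refine ⟨SZ.mul_mem ha hb, fun x hx => ?_⟩
    by_cases h : b x = x
    · exact ha' x (by simpa [Equiv.Perm.mul_apply, h] using hx)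
    · exact hb' x h
  inv_mem' := by
    rintro a ⟨ha, ha'⟩
    refine ⟨SZ.inv_mem ha, fun x hx => ha' x fun h => hx ?_⟩
    rw [Equiv.Perm.inv_eq_iff_eq]; exact h.symm

/-- The set `S_n` of permutations fixing every integer outside `{1, …, n}`. -/
def SFin (n : ℕ) : Set (Equiv.Perm ℤ) := {w | ∀ x : ℤ, w x ≠ x → 1 ≤ x ∧ x ≤ n}

/-- The simple transposition `s_i = (i, i + 1)`. -/
def simple (i : ℤ) : Equiv.Perm ℤ := Equiv.swap i (i + 1)

/-- The inversion set `Inv(w)`. -/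
def inversions (w : Equiv.Perm ℤ) : Set (ℤ × ℤ) := {c | c.1 < c.2 ∧ w c.2 < w c.1}

/-- The length `ℓ(w) = |Inv(w)|`; the set `Inv(w)` is finite for `w ∈ S_ℤ`. -/
noncomputable def length (w : Equiv.Perm ℤ) : ℕ := (inversions w).ncard

/-- `l = (i₁, …, i_k)` encodes a reduced word `(s_{i₁}, …, s_{i_k})` of `w ∈ S_∞`. -/
def IsReducedWord (l : List ℕ+) (w : Equiv.Perm ℤ) : Prop :=
  (l.map fun i : ℕ+ => simple (i : ℤ)).prod = w ∧ l.length = length w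

theorem inversions_finite {w : Equiv.Perm ℤ} (hw : w ∈ SZ) : (inversions w).Finite := by
  have hw' : {x : ℤ | w x ≠ x}.Finite := hw
  obtain ⟨a, ha⟩ := hw'.bddBelow
  obtain ⟨b, hb⟩ := hw'.bddAbove
  have key : ∀ x, w x = x ∨ (a ≤ x ∧ x ≤ b ∧ a ≤ w x ∧ w x ≤ b) := by
    intro x
    by_cases h : w x = x
    · exact Or.inl h
    · have h2 : w (w x) ≠ w x := fun h' => h (w.injective h')
      exact Or.inr ⟨ha h, hb h, ha h2, hb h2⟩
  refine ((Set.finite_Icc a b).prod (Set.finite_Icc a b)).subset ?_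
  rintro ⟨x, y⟩ ⟨h1, h2⟩
  simp only at h1 h2
  simp only [Set.mem_prod, Set.mem_Icc]
  rcases key x with hx | hx <;> rcases key y with hy | hy <;> omega

theorem simple_mem {i : ℤ} (hi : 1 ≤ i) : simple i ∈ SInf := by
  have key : ∀ x : ℤ, simple i x ≠ x → x = i ∨ x = i + 1 := by
    intro x hx
    by_contra h
    push Not at h
    exact hx (Equiv.swap_apply_of_ne_of_ne h.1 h.2)
  refine ⟨?_, ?_⟩
  · exact (Set.toFinite {i, i + 1}).subset fun x hx => key x hx
  · intro x hx
    rcases key x hx with h | h <;> omega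

theorem length_mul_simple {w : Equiv.Perm ℤ} (hw : w ∈ SInf) {i : ℤ} (hi : 1 ≤ i)
    (h : w (i + 1) < w i) : length w = length (w * simple i) + 1 := by
  have hfin : (inversions (w * simple i)).Finite :=
    inversions_finite (SInf.mul_mem hw (simple_mem hi)).1
  have hs : ∀ x : ℤ, (x = i ∧ simple i x = i + 1) ∨ (x = i + 1 ∧ simple i x = i) ∨
      (x ≠ i ∧ x ≠ i + 1 ∧ simple i x = x) := by
    intro x
    by_cases h1 : x = i
    · left; subst h1; exact ⟨rfl, Equiv.swap_apply_left _ _⟩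
    · by_cases h2 : x = i + 1
      · right; left; subst h2; exact ⟨rfl, Equiv.swap_apply_right _ _⟩
      · right; right; exact ⟨h1, h2, Equiv.swap_apply_of_ne_of_ne h1 h2⟩
  have hss : ∀ x : ℤ, simple i (simple i x) = x := fun x => Equiv.swap_apply_self _ _ _
  have hinj : Function.Injective (Prod.map (simple i) (simple i)) :=
    (simple i).injective.prodMap (simple i).injective
  have heq : inversions w =
      insert (i, i + 1) (Prod.map (simple i) (simple i) '' inversions (w * simple i)) := by
    ext ⟨a, b⟩
    simp only [Set.mem_insert_iff, Set.mem_image, Prod.mk.injEq]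
    constructor
    · rintro ⟨h1, h2⟩
      simp only at h1 h2
      by_cases hab : a = i ∧ b = i + 1
      · exact Or.inl hab
      · refine Or.inr ⟨(simple i a, simple i b), ⟨?_, ?_⟩, ?_⟩
        · simp only
          rcases hs a with ha | ha | ha <;> rcases hs b with hb | hb | hb <;> omega
        · simpa [Equiv.Perm.mul_apply, hss] using h2
        · simp [hss]
    · rintro (⟨rfl, rfl⟩ | ⟨⟨c, d⟩, ⟨h1, h2⟩, h3⟩)
      · exact ⟨by simp, h⟩
      · simp only [Prod.map_apply, Prod.mk.injEq] at h3
        obtain ⟨rfl, rfl⟩ := h3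
        simp only [Equiv.Perm.mul_apply] at h1 h2
        refine ⟨?_, h2⟩
        simp only
        by_cases hcd : c = i ∧ d = i + 1
        · obtain ⟨rfl, rfl⟩ := hcd
          have e1 : simple c c = c + 1 := Equiv.swap_apply_left _ _
          have e2 : simple c (c + 1) = c := Equiv.swap_apply_right _ _
          rw [e1, e2] at h2
          omega
        · rcases hs c with ha | ha | ha <;> rcases hs d with hb | hb | hb <;> omega
  have hnot : (i, i + 1) ∉ Prod.map (simple i) (simple i) '' inversions (w * simple i) := by
    rintro ⟨⟨c, d⟩, ⟨h1, h2⟩, h3⟩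
    simp only [Prod.map_apply, Prod.mk.injEq] at h1 h2 h3
    rcases hs c with ha | ha | ha <;> rcases hs d with hb | hb | hb <;> omega
  unfold length
  rw [heq, Set.ncard_insert_of_notMem hnot (hfin.image _), Set.ncard_image_of_injective _ hinj]

theorem exists_descent {w : Equiv.Perm ℤ} (hw : w ∈ SInf) (hne : w ≠ 1) :
    ∃ i : ℕ+, w ((i : ℤ) + 1) < w (i : ℤ) := by
  by_contra hcon
  push Not at hcon
  have hfix : ∀ v ∈ SInf, ∀ x : ℤ, x ≤ 0 → v x = x := by
    intro v hv x hx
    by_contra h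
    have := hv.2 x h
    omega
  have hmono : StrictMono w := by
    apply strictMono_int_of_lt_succ
    intro n
    have hn : w n ≠ w (n + 1) := fun h => by have := w.injective h; omega
    rcases lt_trichotomy n 0 with h | h | h
    · rw [hfix w hw n (by omega), hfix w hw (n + 1) (by omega)]; omega
    · subst h
      rw [hfix w hw 0 le_rfl]
      by_contra h'
      have h1 : w (w (0 + 1)) = w (0 + 1) := hfix w hw _ (by omega)
      have := w.injective h1
      omega
    · have := hcon ⟨n.toNat, by omega⟩
      simp only [PNat.mk_coe, Int.toNat_of_nonneg h.le] at this
      omega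
  have hge : ∀ v : Equiv.Perm ℤ, StrictMono v → v 0 = 0 → ∀ x : ℤ, 0 ≤ x → x ≤ v x := by
    intro v hv h0 x hx
    induction x, hx using Int.leInduction with
    | base => omega
    | succ n _ ih => have := hv (show n < n + 1 by omega); omega
  have hmono' : StrictMono (w⁻¹ : Equiv.Perm ℤ) := by
    intro a b hab
    by_contra h
    have := hmono.monotone (not_lt.mp h)
    simp at this
    omega
  apply hne
  ext x
  rcases le_total x 0 with hx | hx
  · simpa using hfix w hw x hx
  · have h1 := hge w hmono (hfix w hw 0 le_rfl) x hx
    have h2 := hge w⁻¹ hmono' (hfix _ (SInf.inv_mem hw) 0 le_rfl) x hx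
    have h3 := hmono.monotone h2
    simp at h3
    simp
    omega

/-- Every element of `S_∞` has a reduced word. -/
theorem exists_isReducedWord (w : SInf) : ∃ l : List ℕ+, IsReducedWord l w := by
  obtain ⟨w, hw⟩ := w
  induction hk : length w using Nat.strong_induction_on generalizing w with
  | _ k ih =>
    by_cases hne : w = 1
    · subst hne
      refine ⟨[], by simp, ?_⟩
      have : inversions (1 : Equiv.Perm ℤ) = ∅ := by
        ext ⟨a, b⟩
        simp only [inversions, Set.mem_ofPred_eq, Equiv.Perm.one_apply, Set.mem_empty_iff_false,
          iff_false]
        omega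
      simp [length, this]
    · obtain ⟨i, hi⟩ := exists_descent hw hne
      have h1 : (1 : ℤ) ≤ i := by exact_mod_cast i.pos
      have hlen := length_mul_simple hw h1 hi
      obtain ⟨l, hl1, hl2⟩ := ih (length (w * simple i)) (by omega) (w * simple i)
        (SInf.mul_mem hw (simple_mem h1)) rfl
      simp only at hl1 hl2
      refine ⟨l ++ [i], ?_, ?_⟩
      · simp only [List.map_append, List.prod_append, hl1, List.map_cons, List.map_nil,
          List.prod_cons, List.prod_nil, mul_one]
        rw [mul_assoc, show simple (i : ℤ) * simple (i : ℤ) = 1 from Equiv.swap_mul_self _ _,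
          mul_one]
      · simp [hl2, hlen]

/-! ### Divided differences and Schubert polynomials -/

/-- The ring `ℤ[x₁, x₂, …]`; the variable `x_i` is `MvPolynomial.X i` for `i : ℕ+`. -/
abbrev Poly : Type := MvPolynomial ℕ+ ℤ

/-- The action of `s_i` on polynomials, exchanging `x_i` and `x_{i+1}`. -/
noncomputable def simpleAct (i : ℕ+) (f : Poly) : Poly :=
  MvPolynomial.rename (Equiv.swap i (i + 1)) f

theorem sub_dvd_sub_simpleAct (i : ℕ+) (f : Poly) :
    (MvPolynomial.X i - MvPolynomial.X (i + 1) : Poly) ∣ f - simpleAct i f := by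
  unfold simpleAct
  induction f using MvPolynomial.induction_on with
  | C a => simp
  | add p q hp hq =>
    have := dvd_add hp hq
    rwa [show p - MvPolynomial.rename (Equiv.swap i (i + 1)) p +
      (q - MvPolynomial.rename (Equiv.swap i (i + 1)) q) =
      p + q - MvPolynomial.rename (Equiv.swap i (i + 1)) (p + q) by rw [map_add]; ring] at this
  | mul_X p n hp =>
    have hX : (MvPolynomial.X i - MvPolynomial.X (i + 1) : Poly) ∣
        MvPolynomial.X n - MvPolynomial.X (Equiv.swap i (i + 1) n) := by
      by_cases h1 : n = i
      · subst h1; simp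
      · by_cases h2 : n = i + 1
        · subst h2
          rw [Equiv.swap_apply_right]
          exact ⟨-1, by ring⟩
        · simp [Equiv.swap_apply_of_ne_of_ne h1 h2]
    rw [map_mul, MvPolynomial.rename_X]
    have := dvd_add (hp.mul_right (MvPolynomial.X n))
      (hX.mul_left (MvPolynomial.rename (Equiv.swap i (i + 1)) p))
    convert this using 1
    ring

/-- The divided difference `∂_i f = (f - s_i f) / (x_i - x_{i+1})`. -/
noncomputable def dividedDiff (i : ℕ+) (f : Poly) : Poly :=
  Classical.choose (sub_dvd_sub_simpleAct i f)

theorem dividedDiff_spec (i : ℕ+) (f : Poly) :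
    f - simpleAct i f = (MvPolynomial.X i - MvPolynomial.X (i + 1)) * dividedDiff i f :=
  Classical.choose_spec (sub_dvd_sub_simpleAct i f)

/-- The operator `∂_w = ∂_{i₁} ∂_{i₂} ⋯ ∂_{i_k}` for `w ∈ S_∞`, where `(s_{i₁}, …, s_{i_k})` is a
reduced word of `w`. (The operator does not depend on which reduced word is taken.) -/
noncomputable def dividedDiffPerm (w : SInf) (f : Poly) : Poly :=
  (Classical.choose (exists_isReducedWord w)).foldr dividedDiff f

/-- The map exchanging `i` and `n + 1 - i` for `1 ≤ i ≤ n`. -/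
def revFun (n : ℕ) (x : ℤ) : ℤ := if 1 ≤ x ∧ x ≤ n then n + 1 - x else x

theorem revFun_revFun (n : ℕ) (x : ℤ) : revFun n (revFun n x) = x := by
  unfold revFun
  split_ifs <;> omega

/-- The reverse permutation `w_n = n ⋯ 3 2 1`. -/
def rev (n : ℕ) : SInf where
  val := ⟨revFun n, revFun n, revFun_revFun n, revFun_revFun n⟩
  property := by
    have key : ∀ x : ℤ, revFun n x ≠ x → 1 ≤ x ∧ x ≤ n := by
      intro x hx
      by_contra h
      exact hx (if_neg h)
    exact ⟨(Set.finite_Icc (1 : ℤ) n).subset fun x hx => key x hx, fun x hx => (key x hx).1⟩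

/-- The monomial `x^{δ_n} = x₁^{n-1} x₂^{n-2} ⋯ x_{n-1}`. -/
noncomputable def xDelta (n : ℕ) : Poly :=
  ∏ i ∈ Finset.range n, MvPolynomial.X i.succPNat ^ (n - 1 - i)

/-- The polynomial `∂_{v⁻¹ w_n} x^{δ_n}`, which for `v ∈ S_n` is the Schubert polynomial of `v`. -/
noncomputable def schubertIn (n : ℕ) (v : SInf) : Poly :=
  dividedDiffPerm (v⁻¹ * rev n) (xDelta n)

open Classical in
/-- The Schubert polynomial `𝔖_v` of `v ∈ S_∞`, computed in the smallest `S_n` containing `v` (any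
other such `n` gives the same polynomial), with the convention `𝔖_v = 0` if `v ∉ S_∞`. -/
noncomputable def schubert (v : Equiv.Perm ℤ) : Poly :=
  if h : v ∈ SInf then schubertIn (sInf {n : ℕ | v ∈ SFin n}) ⟨v, h⟩ else 0

/-! ### Fixed-point-free involutions -/

/-- The map `i ↦ i - (-1)^i` on `ℤ`. -/
def thetaFun (i : ℤ) : ℤ := if Even i then i - 1 else i + 1

theorem thetaFun_thetaFun (i : ℤ) : thetaFun (thetaFun i) = i := by
  unfold thetaFun
  by_cases h : Even i <;> simp [h, parity_simps]

/-- The permutation `Θ : i ↦ i - (-1)^i` of `ℤ`. -/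
def theta : Equiv.Perm ℤ := ⟨thetaFun, thetaFun, thetaFun_thetaFun, thetaFun_thetaFun⟩

/-- `𝓕_ℤ`, the `S_ℤ`-conjugacy class of `Θ`. -/
def FZ : Set (Equiv.Perm ℤ) := {z | ∃ w ∈ SZ, z = w⁻¹ * theta * w}

/-- `𝓕_∞`, the `S_∞`-conjugacy class of `Θ`. -/
def FInf : Set (Equiv.Perm ℤ) := {z | ∃ w ∈ SInf, z = w⁻¹ * theta * w}

/-- `𝓐_FPF(z)`: the permutations `w ∈ S_ℤ` of minimal length such that `z = w⁻¹ Θ w`. -/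
def fpfAtoms (z : Equiv.Perm ℤ) : Set (Equiv.Perm ℤ) :=
  {w | w ∈ SZ ∧ z = w⁻¹ * theta * w ∧
    ∀ v ∈ SZ, z = v⁻¹ * theta * v → length w ≤ length v}

open Classical in
/-- The FPF involution Schubert polynomial `∑_{w ∈ 𝓐_FPF(z)} 𝔖_w` of `z ∈ 𝓕_∞`, with the convention
that it is `0` if `z ∉ 𝓕_∞`. (The set `𝓐_FPF(z)` is finite, and for `z ∈ 𝓕_∞` it lies in `S_∞`.) -/
noncomputable def fpfSchubert (z : Equiv.Perm ℤ) : Poly :=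
  if z ∈ FInf then ∑ᶠ w ∈ fpfAtoms z, schubert w else 0

/-- `Cyc_ℤ(z)`: the pairs `(p, q)` of integers with `p ≤ q = z(p)`. -/
def cycZ (z : Equiv.Perm ℤ) : Set (ℤ × ℤ) := {c | c.1 ≤ c.2 ∧ c.2 = z c.1}

/-- `Cyc_ℙ(z)`: the pairs `(p, q)` of positive integers with `p ≤ q = z(p)`. -/
def cycP (z : Equiv.Perm ℤ) : Set (ℕ+ × ℕ+) := {c | ((c.1 : ℤ), (c.2 : ℤ)) ∈ cycZ z}

/-- `ℓ_FPF(z) = |Inv(z) - Cyc_ℤ(z)| / 2`. (For `z ∈ 𝓕_ℤ` the set is finite, of even size.) -/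
noncomputable def fpfLength (z : Equiv.Perm ℤ) : ℕ := (inversions z \ cycZ z).ncard / 2

/-- The relation `z = t y t` for a transposition `t = (i, j)` with `ℓ_FPF(y) < ℓ_FPF(t y t)`. -/
def FPFStep (y z : Equiv.Perm ℤ) : Prop :=
  ∃ i j : ℤ, i ≠ j ∧ z = Equiv.swap i j * y * Equiv.swap i j ∧ fpfLength y < fpfLength z

/-- The Bruhat order `y ≤ z` on `𝓕_ℤ`: the weakest partial order containing all the relations
`FPFStep` (which never lead out of `𝓕_ℤ`). -/
def FPFLe (y z : Equiv.Perm ℤ) : Prop := Relation.ReflTransGen FPFStep y z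

/-- The strict Bruhat order on `𝓕_ℤ`. -/
def FPFLt (y z : Equiv.Perm ℤ) : Prop := FPFLe y z ∧ y ≠ z

/-- `z` covers `y` in the Bruhat order on `𝓕_ℤ`: `{y} = {w ∈ 𝓕_ℤ : y ≤ w < z}`. -/
def FPFCovers (y z : Equiv.Perm ℤ) : Prop := {w | w ∈ FZ ∧ FPFLe y w ∧ FPFLt w z} = {y}

/-- `Ψ⁺(y, r)`: the covers of `y` of the form `(r, j) y (r, j)` with `j > r`. -/
def psiPlus (y : Equiv.Perm ℤ) (r : ℤ) : Set (Equiv.Perm ℤ) :=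
  {z | z ∈ FZ ∧ FPFCovers y z ∧ ∃ j : ℤ, r < j ∧ z = Equiv.swap r j * y * Equiv.swap r j}

/-- `Ψ⁻(y, r)`: the covers of `y` of the form `(i, r) y (i, r)` with `i < r`. -/
def psiMinus (y : Equiv.Perm ℤ) (r : ℤ) : Set (Equiv.Perm ℤ) :=
  {z | z ∈ FZ ∧ FPFCovers y z ∧ ∃ i : ℤ, i < r ∧ z = Equiv.swap i r * y * Equiv.swap i r}

end FPFSchubert

namespace FPFSchubert

open MvPolynomial

/-! ### Divided differences -/

/-! The two sides are compared through divided differences. A polynomial killed by every ∂_i is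
constant (`eq_C_of_dividedDiff_eq_zero`), and both sides have constant term zero: x_p + x_q has
none, and every z on the right has positive FPF length, so its atoms contribute Schubert polynomials
of positive degree. It remains to see that each ∂_i takes the same value on both sides, which goes
by induction on the FPF length of y.

On a single polynomial, ∂_i sends the one of z to the one of s_i z s_i if i is a descent of z with
z(i) ≠ i+1, and to 0 otherwise (`dividedDiff_fpfSchubert`): right multiplication by s_i matches the
atoms of z descending at i with the atoms of s_i z s_i. On the left side the Leibniz rule then gives
∂_i(x_p + x_q) times the polynomial of y, plus (x_{s_i p} + x_{s_i q}) times ∂_i of it. On the right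
side ∂_i turns a sum over covers into a sum over `ascentConj`.

If i is not a descent of y, or y(i) = i+1, only y itself can survive on the right
(`eq_of_mem_ascentConj_psiSigned`), with the coefficient ∂_i(x_p + x_q). If i is a descent and y(i)
≠ i+1, the induction hypothesis for s_i y s_i and its cycle (s_i p, s_i q) expands the second
Leibniz term. By `psiSigned_conjSwap_of_descent` the covers occurring there are those in
`ascentConj` and possibly y, and the copies of y cancel the first Leibniz term.

Two reductions make this possible. The operators ∂_w and the polynomials are independent of the
reduced word and of n (`IsReducedWord.foldr_dividedDiff_eq`, `schubertIn_succ`). The order and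
minimality conditions become equations between lengths (`fpfCovers_conjSwap_iff`,
`mem_fpfAtoms_iff`), which can be followed under conjugation by s_i. -/

theorem X_sub_X_ne_zero {i j : ℕ+} (h : i ≠ j) : (X i - X j : Poly) ≠ 0 :=
  sub_ne_zero.2 fun h' => h (X_injective h')

theorem X_sub_X_succ_ne_zero (i : ℕ+) : (X i - X (i + 1) : Poly) ≠ 0 :=
  X_sub_X_ne_zero (PNat.lt_add_right i 1).ne

theorem simpleAct_add (i : ℕ+) (f g : Poly) :
    simpleAct i (f + g) = simpleAct i f + simpleAct i g := map_add _ _ _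

theorem simpleAct_sub (i : ℕ+) (f g : Poly) :
    simpleAct i (f - g) = simpleAct i f - simpleAct i g := map_sub _ _ _

theorem simpleAct_mul (i : ℕ+) (f g : Poly) :
    simpleAct i (f * g) = simpleAct i f * simpleAct i g := map_mul _ _ _

theorem simpleAct_X (i j : ℕ+) : simpleAct i (X j) = X (Equiv.swap i (i + 1) j) :=
  rename_X _ _

theorem simpleAct_X_of_ne {i j : ℕ+} (h : j ≠ i) (h' : j ≠ i + 1) :
    simpleAct i (X j) = X j := by
  rw [simpleAct_X, Equiv.swap_apply_of_ne_of_ne h h']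

theorem simpleAct_X_self (i : ℕ+) : simpleAct i (X i) = X (i + 1) := by
  rw [simpleAct_X, Equiv.swap_apply_left]

theorem simpleAct_X_succ (i : ℕ+) : simpleAct i (X (i + 1)) = X i := by
  rw [simpleAct_X, Equiv.swap_apply_right]

theorem simpleAct_simpleAct (i : ℕ+) (f : Poly) : simpleAct i (simpleAct i f) = f := by
  unfold simpleAct
  rw [rename_rename, ← Equiv.coe_trans]
  simp

theorem dividedDiff_unique {i : ℕ+} {f g : Poly}
    (h : f - simpleAct i f = (X i - X (i + 1)) * g) : dividedDiff i f = g :=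
  mul_left_cancel₀ (X_sub_X_succ_ne_zero i) ((dividedDiff_spec i f).symm.trans h)

theorem dividedDiff_add (i : ℕ+) (f g : Poly) :
    dividedDiff i (f + g) = dividedDiff i f + dividedDiff i g := by
  apply dividedDiff_unique
  rw [simpleAct_add]
  linear_combination dividedDiff_spec i f + dividedDiff_spec i g

theorem dividedDiff_sub (i : ℕ+) (f g : Poly) :
    dividedDiff i (f - g) = dividedDiff i f - dividedDiff i g := by
  apply dividedDiff_unique
  rw [simpleAct_sub]
  linear_combination dividedDiff_spec i f - dividedDiff_spec i g

/-- The divided difference as an additive map. -/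
noncomputable def dividedDiffHom (i : ℕ+) : Poly →+ Poly :=
  AddMonoidHom.mk' (dividedDiff i) (dividedDiff_add i)

theorem dividedDiff_zero (i : ℕ+) : dividedDiff i 0 = 0 := map_zero (dividedDiffHom i)

theorem dividedDiff_mul (i : ℕ+) (f g : Poly) :
    dividedDiff i (f * g) = dividedDiff i f * g + simpleAct i f * dividedDiff i g := by
  apply dividedDiff_unique
  rw [simpleAct_mul]
  linear_combination g * dividedDiff_spec i f + simpleAct i f * dividedDiff_spec i g

theorem simpleAct_dividedDiff (i : ℕ+) (f : Poly) :
    simpleAct i (dividedDiff i f) = dividedDiff i f := by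
  apply mul_left_cancel₀ (X_sub_X_succ_ne_zero i)
  have h := congrArg (simpleAct i) (dividedDiff_spec i f)
  rw [simpleAct_mul, simpleAct_sub, simpleAct_sub, simpleAct_simpleAct, simpleAct_X_self,
    simpleAct_X_succ] at h
  linear_combination h + dividedDiff_spec i f

theorem dividedDiff_eq_zero_iff {i : ℕ+} {f : Poly} :
    dividedDiff i f = 0 ↔ simpleAct i f = f := by
  constructor
  · intro h
    have := dividedDiff_spec i f
    rw [h, mul_zero, sub_eq_zero] at this
    exact this.symm
  · intro h
    apply dividedDiff_unique
    rw [h, sub_self, mul_zero]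

theorem dividedDiff_dividedDiff (i : ℕ+) (f : Poly) : dividedDiff i (dividedDiff i f) = 0 :=
  dividedDiff_eq_zero_iff.2 (simpleAct_dividedDiff i f)

theorem simpleAct_comm {i j : ℕ+} (h : i + 1 < j) (f : Poly) :
    simpleAct i (simpleAct j f) = simpleAct j (simpleAct i f) := by
  unfold simpleAct
  rw [rename_rename, rename_rename]
  congr 2
  have h1 : (i : ℕ) + 1 < j := by exact_mod_cast h
  funext k
  simp only [Function.comp_apply, Equiv.swap_apply_def]
  split_ifs <;> simp only [← PNat.coe_inj, PNat.add_coe, PNat.one_coe] at * <;> omega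

theorem simpleAct_braid (i : ℕ+) (f : Poly) :
    simpleAct i (simpleAct (i + 1) (simpleAct i f)) =
      simpleAct (i + 1) (simpleAct i (simpleAct (i + 1) f)) := by
  have h01 : i < i + 1 := PNat.lt_add_right i 1
  have h12 : i + 1 < i + 1 + 1 := PNat.lt_add_right _ 1
  have e : Equiv.swap i (i + 1) * Equiv.swap (i + 1) (i + 1 + 1) * Equiv.swap i (i + 1) =
      Equiv.swap (i + 1) (i + 1 + 1) * Equiv.swap i (i + 1) *
        Equiv.swap (i + 1) (i + 1 + 1) := by
    rw [Equiv.swap_mul_swap_mul_swap h01.ne (h01.trans h12).ne, Equiv.swap_comm i (i + 1),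
      Equiv.swap_comm (i + 1) (i + 1 + 1),
      Equiv.swap_mul_swap_mul_swap h12.ne' (h01.trans h12).ne', Equiv.swap_comm]
  unfold simpleAct
  simp only [rename_rename]
  congr 2
  exact congrArg DFunLike.coe e

theorem dividedDiff_comm {i j : ℕ+} (h : i + 1 < j) (f : Poly) :
    dividedDiff i (dividedDiff j f) = dividedDiff j (dividedDiff i f) := by
  have hi : i < i + 1 := PNat.lt_add_right i 1
  have hj : j < j + 1 := PNat.lt_add_right j 1
  symm
  apply dividedDiff_unique
  have e1 : simpleAct j (dividedDiff i f) = dividedDiff i (simpleAct j f) := by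
    symm
    apply dividedDiff_unique
    have := congrArg (simpleAct j) (dividedDiff_spec i f)
    rw [simpleAct_mul, simpleAct_sub, simpleAct_sub, ← simpleAct_comm h,
      simpleAct_X_of_ne (hi.trans h).ne (hi.trans (h.trans hj)).ne,
      simpleAct_X_of_ne h.ne (h.trans hj).ne] at this
    exact this
  rw [e1, ← dividedDiff_sub, dividedDiff_spec j f, dividedDiff_mul]
  have e2 : simpleAct i (X j - X (j + 1)) = X j - X (j + 1) := by
    rw [simpleAct_sub, simpleAct_X_of_ne (hi.trans h).ne' h.ne',
      simpleAct_X_of_ne (hi.trans (h.trans hj)).ne' (h.trans hj).ne']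
  rw [e2, dividedDiff_eq_zero_iff.2 e2]
  ring

theorem dividedDiff_braid (i : ℕ+) (f : Poly) :
    dividedDiff i (dividedDiff (i + 1) (dividedDiff i f)) =
      dividedDiff (i + 1) (dividedDiff i (dividedDiff (i + 1) f)) := by
  have h01 : i < i + 1 := PNat.lt_add_right i 1
  have h12 : i + 1 < i + 1 + 1 := PNat.lt_add_right _ 1
  have a1 := simpleAct_X_self i
  have b1 := simpleAct_X_succ i
  have c1 : simpleAct i (X (i + 1 + 1)) = X (i + 1 + 1) :=
    simpleAct_X_of_ne (h01.trans h12).ne' h12.ne'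
  have a2 : simpleAct (i + 1) (X i) = X i := simpleAct_X_of_ne h01.ne (h01.trans h12).ne
  have b2 := simpleAct_X_self (i + 1)
  have c2 := simpleAct_X_succ (i + 1)
  have hbr := simpleAct_braid i f
  have n1 := X_sub_X_succ_ne_zero i
  have n2 := X_sub_X_succ_ne_zero (i + 1)
  have n3 : (X i - X (i + 1 + 1) : Poly) ≠ 0 := X_sub_X_ne_zero (h01.trans h12).ne
  have g0 := dividedDiff_spec i f
  have gs := simpleAct_dividedDiff i f
  set g := dividedDiff i f
  have k0 := dividedDiff_spec (i + 1) g
  set h := dividedDiff (i + 1) g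
  have m0 := dividedDiff_spec i h
  set k := dividedDiff i h
  have g0' := dividedDiff_spec (i + 1) f
  have gs' := simpleAct_dividedDiff (i + 1) f
  set g' := dividedDiff (i + 1) f
  have k0' := dividedDiff_spec i g'
  set h' := dividedDiff i g'
  have m0' := dividedDiff_spec (i + 1) h'
  set k' := dividedDiff (i + 1) h'
  have t1 := congrArg (simpleAct i) k0
  have t2 := congrArg (simpleAct (i + 1)) g0
  have t3 := congrArg (simpleAct i) t2
  have u1 := congrArg (simpleAct (i + 1)) k0'
  have u2 := congrArg (simpleAct i) g0'
  have u3 := congrArg (simpleAct (i + 1)) u2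
  simp only [simpleAct_mul, simpleAct_sub, a1, b1, c1, a2, b2, c2, gs, gs'] at t1 t2 t3 u1 u2 u3
  -- After multiplication by the Vandermonde product of the three variables, both sides become the
  -- alternating sum of f over S_3; `hbr` identifies the two expressions for the longest element.
  apply mul_left_cancel₀ (mul_ne_zero (mul_ne_zero n1 n2) n3)
  linear_combination (-(X (i + 1) - X (i + 1 + 1)) * (X i - X (i + 1 + 1))) * m0
    + (X i - X (i + 1)) * (X i - X (i + 1 + 1)) * m0'
    - (X i - X (i + 1 + 1)) * k0 + (X (i + 1) - X (i + 1 + 1)) * t1 - g0 + t2 - t3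
    + (X i - X (i + 1 + 1)) * k0' - (X i - X (i + 1)) * u1 + g0' - u2 + u3 - hbr

-- Divided differences and degree.

attribute [local instance] MvPolynomial.gradedAlgebra in
theorem homogeneousComponent_add_mul {m : ℕ} {a : Poly} (ha : a.IsHomogeneous m) (b : Poly)
    (n : ℕ) : homogeneousComponent (m + n) (a * b) = a * homogeneousComponent n b := by
  have := DirectSum.coe_decompose_mul_add_of_left_mem (homogeneousSubmodule ℕ+ ℤ) (b := b) (j := n)
    ((mem_homogeneousSubmodule _ _).2 ha)
  rw [← decomposition.decompose'_apply, ← decomposition.decompose'_apply]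
  exact this

/-- Multiplying the degree n component of ∂_i f by x_i - x_{i+1} gives the degree n+1 component of f
- s_i f, which is all of it; by uniqueness of the quotient that component is ∂_i f. -/
theorem isHomogeneous_dividedDiff {i : ℕ+} {f : Poly} {n : ℕ} (hf : f.IsHomogeneous (n + 1)) :
    (dividedDiff i f).IsHomogeneous n := by
  have h1 : (f - simpleAct i f).IsHomogeneous (n + 1) := hf.sub hf.rename_isHomogeneous
  have h2 : (X i - X (i + 1) : Poly).IsHomogeneous 1 :=
    (isHomogeneous_X _ _).sub (isHomogeneous_X _ _)
  have h3 : dividedDiff i f = homogeneousComponent n (dividedDiff i f) := by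
    apply dividedDiff_unique
    have := homogeneousComponent_add_mul h2 (dividedDiff i f) n
    rw [← dividedDiff_spec, add_comm, homogeneousComponent_eq_self h1] at this
    exact this
  rw [h3]
  exact homogeneousComponent_isHomogeneous _ _

theorem dividedDiff_of_isHomogeneous_zero {i : ℕ+} {f : Poly} (hf : f.IsHomogeneous 0) :
    dividedDiff i f = 0 := by
  rw [dividedDiff_eq_zero_iff, ← totalDegree_zero_iff_isHomogeneous] at *
  rw [totalDegree_eq_zero_iff_eq_C] at hf
  rw [hf]
  simp [simpleAct]

/-- Such an f is invariant under every s_i. If x_m were its last variable, invariance under s_m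
would make x_{m+1} occur as well. -/
theorem eq_C_of_dividedDiff_eq_zero {f : Poly} (h : ∀ i, dividedDiff i f = 0) :
    f = C (constantCoeff f) := by
  have hv : f.vars = ∅ := by
    by_contra hne
    have hne := Finset.nonempty_iff_ne_empty.2 hne
    set m := f.vars.max' hne
    have hm := f.vars.max'_mem hne
    have h1 := dividedDiff_eq_zero_iff.1 (h m)
    have hm' : m ∈ (simpleAct m f).vars := by rwa [h1]
    obtain ⟨k, hk, hkm⟩ := Finset.mem_image.1 (vars_rename _ _ hm')
    obtain rfl : k = m + 1 := by
      rw [← Equiv.swap_apply_left m (m + 1)]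
      exact (Equiv.swap_apply_eq_iff.1 hkm)
    exact absurd (f.vars.le_max' _ hk) (not_le.2 (PNat.lt_add_right m 1))
  exact vars_eq_empty_iff_eq_C.1 hv

/-! ### Simple transpositions of ℤ. -/

theorem simple_mem_SZ (i : ℤ) : simple i ∈ SZ :=
  (Set.toFinite {i, i + 1}).subset fun x hx => by
    by_contra h
    simp only [Set.mem_insert_iff, Set.mem_singleton_iff, not_or] at h
    exact hx (Equiv.swap_apply_of_ne_of_ne h.1 h.2)

theorem simple_apply_left (i : ℤ) : simple i i = i + 1 := Equiv.swap_apply_left _ _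

theorem simple_apply_right (i : ℤ) : simple i (i + 1) = i := Equiv.swap_apply_right _ _

theorem simple_apply_of_ne {i x : ℤ} (h : x ≠ i) (h' : x ≠ i + 1) : simple i x = x :=
  Equiv.swap_apply_of_ne_of_ne h h'

theorem simple_simple (i x : ℤ) : simple i (simple i x) = x := Equiv.swap_apply_self _ _ _

theorem simple_mul_self (i : ℤ) : simple i * simple i = 1 := Equiv.swap_mul_self _ _

theorem simple_inv (i : ℤ) : (simple i)⁻¹ = simple i := Equiv.swap_inv _ _

theorem simple_mul_simple_mul (i : ℤ) (w : Equiv.Perm ℤ) : simple i * (simple i * w) = w := by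
  rw [← mul_assoc, simple_mul_self, one_mul]

theorem mul_simple_mul_simple (i : ℤ) (w : Equiv.Perm ℤ) : w * simple i * simple i = w := by
  rw [mul_assoc, simple_mul_self, mul_one]

theorem simple_cases (i x : ℤ) : (x = i ∧ simple i x = i + 1) ∨ (x = i + 1 ∧ simple i x = i) ∨
    (x ≠ i ∧ x ≠ i + 1 ∧ simple i x = x) := by
  by_cases h1 : x = i
  · left; subst h1; exact ⟨rfl, simple_apply_left _⟩
  · by_cases h2 : x = i + 1
    · right; left; subst h2; exact ⟨rfl, simple_apply_right _⟩
    · right; right; exact ⟨h1, h2, simple_apply_of_ne h1 h2⟩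

/-! ### Length -/

/-- Applying s_i to both coordinates carries the inversions of w s_i to those of w other than (i,
i+1). -/
theorem length_eq_length_mul_simple_add_one {w : Equiv.Perm ℤ} (hw : w ∈ SZ) {i : ℤ}
    (h : w (i + 1) < w i) : length w = length (w * simple i) + 1 := by
  have hfin : (inversions (w * simple i)).Finite :=
    inversions_finite (SZ.mul_mem hw (simple_mem_SZ i))
  have hinj : Function.Injective (Prod.map (simple i) (simple i)) :=
    (simple i).injective.prodMap (simple i).injective
  have heq : inversions w =
      insert (i, i + 1) (Prod.map (simple i) (simple i) '' inversions (w * simple i)) := by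
    ext ⟨a, b⟩
    simp only [Set.mem_insert_iff, Set.mem_image, Prod.mk.injEq]
    constructor
    · rintro ⟨h1, h2⟩
      simp only at h1 h2
      by_cases hab : a = i ∧ b = i + 1
      · exact Or.inl hab
      · refine Or.inr ⟨(simple i a, simple i b), ⟨?_, ?_⟩, ?_⟩
        · simp only
          rcases simple_cases i a with ha | ha | ha <;>
            rcases simple_cases i b with hb | hb | hb <;> omega
        · simpa [Equiv.Perm.mul_apply, simple_simple] using h2
        · simp [simple_simple]
    · rintro (⟨rfl, rfl⟩ | ⟨⟨c, d⟩, ⟨h1, h2⟩, h3⟩)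
      · exact ⟨by simp, h⟩
      · simp only [Prod.map_apply, Prod.mk.injEq] at h3
        obtain ⟨rfl, rfl⟩ := h3
        simp only [Equiv.Perm.mul_apply] at h1 h2
        refine ⟨?_, h2⟩
        simp only
        by_cases hcd : c = i ∧ d = i + 1
        · obtain ⟨rfl, rfl⟩ := hcd
          rw [simple_apply_left, simple_apply_right] at h2
          omega
        · rcases simple_cases i c with ha | ha | ha <;>
            rcases simple_cases i d with hb | hb | hb <;> omega
  have hnot : (i, i + 1) ∉ Prod.map (simple i) (simple i) '' inversions (w * simple i) := by
    rintro ⟨⟨c, d⟩, ⟨h1, h2⟩, h3⟩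
    simp only [Prod.map_apply, Prod.mk.injEq] at h1 h2 h3
    rcases simple_cases i c with ha | ha | ha <;>
      rcases simple_cases i d with hb | hb | hb <;> omega
  unfold length
  rw [heq, Set.ncard_insert_of_notMem hnot (hfin.image _), Set.ncard_image_of_injective _ hinj]

theorem length_mul_simple_of_lt {w : Equiv.Perm ℤ} (hw : w ∈ SZ) {i : ℤ}
    (h : w i < w (i + 1)) : length (w * simple i) = length w + 1 := by
  have := length_eq_length_mul_simple_add_one (SZ.mul_mem hw (simple_mem_SZ i)) (i := i)
    (by simpa [Equiv.Perm.mul_apply, simple_apply_left, simple_apply_right] using h)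
  rwa [mul_simple_mul_simple] at this

theorem length_inv (w : Equiv.Perm ℤ) : length w⁻¹ = length w := by
  have heq : inversions w⁻¹ = (fun c : ℤ × ℤ => (w c.2, w c.1)) '' inversions w := by
    ext ⟨a, b⟩
    simp only [inversions, Set.mem_ofPred_eq, Set.mem_image, Prod.mk.injEq, Prod.exists]
    constructor
    · rintro ⟨h1, h2⟩
      exact ⟨w⁻¹ b, w⁻¹ a, ⟨h2, by simpa using h1⟩, by simp, by simp⟩
    · rintro ⟨c, d, ⟨h1, h2⟩, rfl, rfl⟩
      exact ⟨h2, by simpa using h1⟩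
  unfold length
  rw [heq]
  apply Set.ncard_image_of_injective
  rintro ⟨a, b⟩ ⟨c, d⟩ h
  simpa [and_comm] using h

theorem length_eq_length_simple_mul_add_one {w : Equiv.Perm ℤ} (hw : w ∈ SZ) {i : ℤ}
    (h : w⁻¹ (i + 1) < w⁻¹ i) : length w = length (simple i * w) + 1 := by
  rw [← length_inv w, length_eq_length_mul_simple_add_one (SZ.inv_mem hw) h,
    ← length_inv (simple i * w), mul_inv_rev, simple_inv]

theorem length_simple_mul_of_lt {w : Equiv.Perm ℤ} (hw : w ∈ SZ) {i : ℤ}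
    (h : w⁻¹ i < w⁻¹ (i + 1)) : length (simple i * w) = length w + 1 := by
  rw [← length_inv (simple i * w), mul_inv_rev, simple_inv,
    length_mul_simple_of_lt (SZ.inv_mem hw) h, length_inv]

theorem length_one : length 1 = 0 := by
  have : inversions (1 : Equiv.Perm ℤ) = ∅ := by
    ext ⟨a, b⟩
    simp only [inversions, Set.mem_ofPred_eq, Equiv.Perm.one_apply, Set.mem_empty_iff_false,
      iff_false]
    omega
  simp [length, this]

theorem apply_ne_apply_succ (w : Equiv.Perm ℤ) (i : ℤ) : w i ≠ w (i + 1) :=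
  fun h => by have := w.injective h; omega

/-- A nontrivial finitely supported permutation of `ℤ` has a descent. -/
theorem exists_descent_of_mem_SZ {w : Equiv.Perm ℤ} (hw : w ∈ SZ) (hne : w ≠ 1) :
    ∃ i : ℤ, w (i + 1) < w i := by
  by_contra hcon
  push Not at hcon
  have hmono : ∀ i, w i + 1 ≤ w (i + 1) := fun i => by
    have := hcon i
    have := apply_ne_apply_succ w i
    omega
  have hw' : {x : ℤ | w x ≠ x}.Finite := hw
  obtain ⟨a, ha⟩ := hw'.bddBelow
  obtain ⟨b, hb⟩ := hw'.bddAbove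
  apply hne
  ext x
  -- Without descents w increases by at least 1 at each step. Starting from a fixed point left of
  -- the support this gives x ≤ w x, and starting from one to the right it gives w x ≤ x.
  have hlow : x ≤ w x := by
    have h0 : w (min x (a - 1)) = min x (a - 1) := by
      by_contra h
      have := ha h
      omega
    have key : ∀ k, min x (a - 1) ≤ k → k ≤ w k := fun k hk => by
      induction k, hk using Int.leInduction with
      | base => omega
      | succ n _ ih => have := hmono n; omega
    exact key x (min_le_left _ _)
  have hup : w x ≤ x := by
    have h0 : w (max x (b + 1)) = max x (b + 1) := by
      by_contra h
      have := hb h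
      omega
    have key : ∀ k, k ≤ max x (b + 1) → w k ≤ k := fun k hk => by
      induction k, hk using Int.leInductionDown with
      | base => omega
      | pred n _ ih => have := hmono (n - 1); rw [sub_add_cancel] at this; omega
    exact key x (le_max_left _ _)
  simp
  omega

/-! ### Reduced words -/

theorem length_wordProd_le (l : List ℕ+) :
    (l.map fun i : ℕ+ => simple (i : ℤ)).prod ∈ SInf ∧
      length (l.map fun i : ℕ+ => simple (i : ℤ)).prod ≤ l.length := by
  induction l with
  | nil => simp [length_one, SInf.one_mem]
  | cons i l ih =>
    obtain ⟨h1, h2⟩ := ih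
    simp only [List.map_cons, List.prod_cons, List.length_cons]
    refine ⟨SInf.mul_mem (simple_mem (by exact_mod_cast i.pos)) h1, ?_⟩
    set u := (l.map fun i : ℕ+ => simple (i : ℤ)).prod
    rcases lt_or_gt_of_ne (apply_ne_apply_succ u⁻¹ i) with h | h
    · rw [length_simple_mul_of_lt h1.1 h]; omega
    · have := length_eq_length_simple_mul_add_one h1.1 h
      omega

theorem isReducedWord_cons {i : ℕ+} {l : List ℕ+} {w : Equiv.Perm ℤ} (hw : w ∈ SInf)
    (h : w⁻¹ ((i : ℤ) + 1) < w⁻¹ i) (hl : IsReducedWord l (simple i * w)) :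
    IsReducedWord (i :: l) w := by
  refine ⟨?_, ?_⟩
  · rw [List.map_cons, List.prod_cons, hl.1, simple_mul_simple_mul]
  · rw [List.length_cons, hl.2, length_eq_length_simple_mul_add_one hw.1 h]

/-- If i were not a left descent, s_i w would have length ℓ(w) + 1, yet the tail of the word
expresses it with only ℓ(w) - 1 letters. -/
theorem IsReducedWord.of_cons {i : ℕ+} {l : List ℕ+} {w : Equiv.Perm ℤ} (hw : w ∈ SInf)
    (hl : IsReducedWord (i :: l) w) :
    w⁻¹ ((i : ℤ) + 1) < w⁻¹ i ∧ IsReducedWord l (simple i * w) := by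
  obtain ⟨h1, h2⟩ := hl
  rw [List.map_cons, List.prod_cons] at h1
  have h3 : (l.map fun i : ℕ+ => simple (i : ℤ)).prod = simple i * w := by
    rw [← h1, simple_mul_simple_mul]
  have h4 := (length_wordProd_le l).2
  rw [h3] at h4
  rw [List.length_cons] at h2
  have h5 : w⁻¹ ((i : ℤ) + 1) < w⁻¹ i := by
    rcases lt_or_gt_of_ne (apply_ne_apply_succ w⁻¹ i) with h | h
    · have := length_simple_mul_of_lt hw.1 h
      omega
    · exact h
  have := length_eq_length_simple_mul_add_one hw.1 h5
  exact ⟨h5, h3, by omega⟩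

theorem simple_mul_mem {w : Equiv.Perm ℤ} (hw : w ∈ SInf) (i : ℕ+) : simple i * w ∈ SInf :=
  SInf.mul_mem (simple_mem (by exact_mod_cast i.pos)) hw

theorem exists_isReducedWord_of_mem {w : Equiv.Perm ℤ} (hw : w ∈ SInf) :
    ∃ l : List ℕ+, IsReducedWord l w := exists_isReducedWord ⟨w, hw⟩

/-- Two left descents can be the first letters of reduced words giving the same operator. -/
theorem exists_isReducedWord_pair {w : Equiv.Perm ℤ} (hw : w ∈ SInf) {i j : ℕ+} (hij : i < j)
    (hi : w⁻¹ ((i : ℤ) + 1) < w⁻¹ i) (hj : w⁻¹ ((j : ℤ) + 1) < w⁻¹ j) :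
    ∃ l l' : List ℕ+, IsReducedWord (i :: l) w ∧ IsReducedWord (j :: l') w ∧
      ∀ f, (i :: l).foldr dividedDiff f = (j :: l').foldr dividedDiff f := by
  have mi := simple_mul_mem hw i
  have mj := simple_mul_mem hw j
  rcases eq_or_lt_of_le (show i + 1 ≤ j from hij) with h | h
  · subst h
    have mji := simple_mul_mem mi (i + 1)
    have mij := simple_mul_mem mj i
    obtain ⟨m, hm⟩ := exists_isReducedWord_of_mem (simple_mul_mem mji i)
    have hbr : simple i * (simple (i + 1 : ℕ+) * (simple i * w)) =
        simple (i + 1 : ℕ+) * (simple i * (simple (i + 1 : ℕ+) * w)) := by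
      have e : simple i * simple (i + 1 : ℕ+) * simple i =
          simple (i + 1 : ℕ+) * simple i * simple (i + 1 : ℕ+) := by
        unfold simple
        push_cast
        have h01 : (i : ℤ) ≠ i + 1 := by omega
        have h02 : (i : ℤ) ≠ i + 1 + 1 := by omega
        have h12 : (i : ℤ) + 1 ≠ i + 1 + 1 := by omega
        rw [Equiv.swap_mul_swap_mul_swap h01 h02, Equiv.swap_comm (i : ℤ) (i + 1),
          Equiv.swap_comm ((i : ℤ) + 1) (i + 1 + 1),
          Equiv.swap_mul_swap_mul_swap h12.symm h02.symm, Equiv.swap_comm]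
      simp only [← mul_assoc, e]
    have hc : ((i + 1 : ℕ+) : ℤ) = (i : ℤ) + 1 := by push_cast; rfl
    have hc' : ((i + 1 : ℕ+) : ℕ) = (i : ℕ) + 1 := rfl
    have e1 : simple i ((i : ℤ) + 1 + 1) = i + 1 + 1 := simple_apply_of_ne (by omega) (by omega)
    have e2 : simple ((i : ℤ) + 1) (i : ℤ) = i := simple_apply_of_ne (by omega) (by omega)
    have e3 := simple_apply_right ((i : ℤ) + 1)
    have e4 := simple_apply_left ((i : ℤ) + 1)
    rw [hc] at hj
    -- With adjacent left descents i and i+1, w starts with the longest element of the S_3 they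
    -- generate; the two words are its two reduced words, continued by a common reduced word m of
    -- the rest.
    refine ⟨(i + 1) :: i :: m, i :: (i + 1) :: m, ?_, ?_, fun f => ?_⟩
    · refine isReducedWord_cons hw hi (isReducedWord_cons mi ?_ (isReducedWord_cons mji ?_ hm))
      · simp only [hc, mul_inv_rev, Equiv.Perm.mul_apply, simple_inv, e1, simple_apply_right]
        omega
      · simp only [hc, mul_inv_rev, Equiv.Perm.mul_apply, simple_inv, e1, e2, e4,
          simple_apply_left]
        exact hj
    · rw [hbr] at hm
      refine isReducedWord_cons hw (by rwa [hc])
        (isReducedWord_cons mj ?_ (isReducedWord_cons mij ?_ hm))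
      · simp only [hc, mul_inv_rev, Equiv.Perm.mul_apply, simple_inv, e2, e4]
        omega
      · simp only [hc, mul_inv_rev, Equiv.Perm.mul_apply, simple_inv, e1, e2, e3,
          simple_apply_right]
        exact hi
    · exact dividedDiff_braid i _
  · have h' : (i : ℤ) + 1 < j := by exact_mod_cast h
    obtain ⟨m, hm⟩ := exists_isReducedWord_of_mem (simple_mul_mem mi j)
    have hcm : simple j * (simple i * w) = simple i * (simple j * w) := by
      rw [← mul_assoc, ← mul_assoc]
      congr 1
      exact (Equiv.Perm.Disjoint.commute fun x => by
        rcases simple_cases i x with hx | hx | hx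
        · exact Or.inl (simple_apply_of_ne (by omega) (by omega))
        · exact Or.inl (simple_apply_of_ne (by omega) (by omega))
        · exact Or.inr hx.2.2)
    refine ⟨j :: m, i :: m, ?_, ?_, fun f => ?_⟩
    · refine isReducedWord_cons hw hi (isReducedWord_cons mi ?_ hm)
      simp only [mul_inv_rev, Equiv.Perm.mul_apply, simple_inv]
      rwa [simple_apply_of_ne (by omega) (by omega), simple_apply_of_ne (by omega) (by omega)]
    · rw [hcm] at hm
      refine isReducedWord_cons hw hj (isReducedWord_cons mj ?_ hm)
      simp only [mul_inv_rev, Equiv.Perm.mul_apply, simple_inv]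
      rwa [simple_apply_of_ne (by omega) (by omega), simple_apply_of_ne (by omega) (by omega)]
    · exact dividedDiff_comm h _

/-- The composite of divided differences along a reduced word depends only on the permutation. -/
theorem IsReducedWord.foldr_dividedDiff_eq {l l' : List ℕ+} {w : Equiv.Perm ℤ} (hw : w ∈ SInf)
    (hl : IsReducedWord l w) (hl' : IsReducedWord l' w) (f : Poly) :
    l.foldr dividedDiff f = l'.foldr dividedDiff f := by
  induction hn : length w using Nat.strong_induction_on generalizing w l l' with
  | _ n ih =>
    cases l with
    | nil =>
      have h1 := hl.2
      have h2 := hl'.2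
      rw [← h1] at h2
      obtain rfl := List.length_eq_zero_iff.1 (show l'.length = 0 by simpa using h2)
      rfl
    | cons i l =>
      cases l' with
      | nil =>
        have h1 := hl.2
        have h2 := hl'.2
        simp only [List.length_cons, List.length_nil] at h1 h2
        omega
      | cons j l' =>
        have step : ∀ {i : ℕ+} {l l' : List ℕ+}, IsReducedWord (i :: l) w →
            IsReducedWord (i :: l') w →
            (i :: l).foldr dividedDiff f = (i :: l').foldr dividedDiff f := by
          intro i l l' hl hl'
          obtain ⟨h1, h2⟩ := hl.of_cons hw
          obtain ⟨_, h3⟩ := hl'.of_cons hw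
          have := length_eq_length_simple_mul_add_one hw.1 h1
          rw [List.foldr_cons, List.foldr_cons,
            ih _ (by omega) (simple_mul_mem hw i) h2 h3 rfl]
        -- When the first letters differ, two intermediate words are inserted: each shares its first
        -- letter with one of the given words, and the two are related by a braid or commutation
        -- move.
        rcases lt_trichotomy i j with h | h | h
        · obtain ⟨m, m', h1, h2, h3⟩ :=
            exists_isReducedWord_pair hw h (hl.of_cons hw).1 (hl'.of_cons hw).1
          rw [step hl h1, h3, step h2 hl']
        · subst h
          exact step hl hl'
        · obtain ⟨m, m', h1, h2, h3⟩ :=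
            exists_isReducedWord_pair hw h (hl'.of_cons hw).1 (hl.of_cons hw).1
          rw [step hl h2, ← h3, step h1 hl']

theorem dividedDiffPerm_one (f : Poly) : dividedDiffPerm 1 f = f := by
  have h := Classical.choose_spec (exists_isReducedWord 1)
  exact h.foldr_dividedDiff_eq (l' := []) SInf.one_mem ⟨rfl, length_one.symm⟩ f

theorem dividedDiffPerm_of_descent (i : ℕ+) (w : SInf)
    (h : (w : Equiv.Perm ℤ)⁻¹ ((i : ℤ) + 1) < (w : Equiv.Perm ℤ)⁻¹ i) (f : Poly) :
    dividedDiffPerm w f =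
      dividedDiff i (dividedDiffPerm ⟨simple i * w, simple_mul_mem w.2 i⟩ f) := by
  have h1 := Classical.choose_spec (exists_isReducedWord w)
  have h2 := Classical.choose_spec
    (exists_isReducedWord ⟨simple i * w, simple_mul_mem w.2 i⟩)
  exact h1.foldr_dividedDiff_eq w.2 (isReducedWord_cons w.2 h h2) f

/-! ### Schubert polynomials -/

theorem SFin_mono {m n : ℕ} (h : m ≤ n) {v : Equiv.Perm ℤ} (hv : v ∈ SFin m) : v ∈ SFin n :=
  fun x hx => ⟨(hv x hx).1, (hv x hx).2.trans (by exact_mod_cast h)⟩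

theorem SFin_apply_mem {n : ℕ} {v : Equiv.Perm ℤ} (hv : v ∈ SFin n) {x : ℤ} (h1 : 1 ≤ x)
    (h2 : x ≤ n) : 1 ≤ v x ∧ v x ≤ n := by
  by_cases h : v x = x
  · rw [h]; exact ⟨h1, h2⟩
  · exact hv _ fun h' => h (v.injective h')

theorem SFin_apply_of_lt {n : ℕ} {v : Equiv.Perm ℤ} (hv : v ∈ SFin n) {x : ℤ}
    (h : (n : ℤ) < x) : v x = x := by
  by_contra h'
  have := hv x h'
  omega

theorem SFin_mul {n : ℕ} {v w : Equiv.Perm ℤ} (hv : v ∈ SFin n) (hw : w ∈ SFin n) :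
    v * w ∈ SFin n := fun x hx => by
  by_cases h : w x = x
  · exact hv x (by simpa [Equiv.Perm.mul_apply, h] using hx)
  · exact hw x h

theorem simple_mem_SFin {n : ℕ} {i : ℕ+} (hi : (i : ℕ) < n) : simple (i : ℤ) ∈ SFin n :=
  fun x hx => by
    have := i.pos
    rcases simple_cases i x with h | h | h
    · omega
    · omega
    · exact absurd h.2.2 hx

theorem exists_mem_SFin {v : Equiv.Perm ℤ} (hv : v ∈ SInf) : ∃ n : ℕ, v ∈ SFin n := by
  have hf : {x : ℤ | v x ≠ x}.Finite := hv.1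
  obtain ⟨b, hb⟩ := hf.bddAbove
  refine ⟨b.toNat, fun x hx => ⟨hv.2 x hx, ?_⟩⟩
  have := hb hx
  omega

theorem mul_simple_mem {w : Equiv.Perm ℤ} (hw : w ∈ SInf) (i : ℕ+) : w * simple i ∈ SInf :=
  SInf.mul_mem hw (simple_mem (by exact_mod_cast i.pos))

theorem rev_apply {n : ℕ} {x : ℤ} (h1 : 1 ≤ x) (h2 : x ≤ n) :
    (rev n : Equiv.Perm ℤ) x = n + 1 - x := if_pos ⟨h1, h2⟩

theorem rev_mem_SFin (n : ℕ) : (rev n : Equiv.Perm ℤ) ∈ SFin n := fun x hx => by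
  by_contra h
  exact hx (if_neg h)

theorem rev_inv (n : ℕ) : (rev n : Equiv.Perm ℤ)⁻¹ = rev n := rfl

/-- The inverse of v⁻¹ w_n is w_n v, so an ascent of v at i is a left descent of v⁻¹ w_n, and
removing that letter gives (v s_i)⁻¹ w_n. -/
theorem schubertIn_of_ascent {n : ℕ} {v : SInf} (hv : (v : Equiv.Perm ℤ) ∈ SFin n) {i : ℕ+}
    (hi : (i : ℕ) < n) (h : (v : Equiv.Perm ℤ) i < (v : Equiv.Perm ℤ) (i + 1)) :
    schubertIn n v = dividedDiff i (schubertIn n ⟨v * simple i, mul_simple_mem v.2 i⟩) := by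
  unfold schubertIn
  have hp := i.pos
  rw [dividedDiffPerm_of_descent i]
  · congr 2
  · have a := SFin_apply_mem hv (x := i) (by omega) (by omega)
    have b := SFin_apply_mem hv (x := i + 1) (by omega) (by omega)
    have e : ((v⁻¹ * rev n : SInf) : Equiv.Perm ℤ)⁻¹ = rev n * v := by
      simp [mul_inv_rev, rev_inv]
    rw [e, Equiv.Perm.mul_apply, Equiv.Perm.mul_apply, rev_apply a.1 a.2, rev_apply b.1 b.2]
    omega

theorem schubertIn_rev (n : ℕ) : schubertIn n (rev n) = xDelta n := by
  unfold schubertIn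
  rw [inv_mul_cancel, dividedDiffPerm_one]

/-- A permutation in `S_n` other than `w_n` has an ascent below `n`. -/
theorem exists_ascent {n : ℕ} {v : Equiv.Perm ℤ} (hv : v ∈ SFin n)
    (hne : v ≠ rev n) : ∃ i : ℕ+, (i : ℕ) < n ∧ v i < v (i + 1) := by
  have hw : (rev n : Equiv.Perm ℤ) * v ∈ SFin n := SFin_mul (rev_mem_SFin n) hv
  have hm : v ∈ SInf := ⟨(Set.finite_Icc (1 : ℤ) n).subset fun x hx => hv x hx,
    fun x hx => (hv x hx).1⟩
  obtain ⟨i, hi⟩ := exists_descent (SInf.mul_mem (rev n).2 hm) (fun h => hne (by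
    rw [← rev_inv]; exact eq_inv_of_mul_eq_one_right h))
  have hp := i.pos
  have hin : (i : ℕ) < n := by
    by_contra hge
    rw [SFin_apply_of_lt hw (x := i + 1) (by omega)] at hi
    rcases eq_or_lt_of_le (show (n : ℤ) ≤ i by omega) with h | h
    · have := SFin_apply_mem hw (x := i) (by omega) (by omega)
      omega
    · rw [SFin_apply_of_lt hw h] at hi
      omega
  refine ⟨i, hin, ?_⟩
  have a := SFin_apply_mem hv (x := i) (by omega) (by omega)
  have b := SFin_apply_mem hv (x := i + 1) (by omega) (by omega)
  rw [Equiv.Perm.mul_apply, Equiv.Perm.mul_apply, rev_apply a.1 a.2, rev_apply b.1 b.2] at hi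
  omega

/-- Induction downwards from the longest element of `S_n`. -/
theorem SFin_induction {n : ℕ} {P : SInf → Prop} (base : P (rev n))
    (step : ∀ (v : SInf) (i : ℕ+), (v : Equiv.Perm ℤ) ∈ SFin n → (i : ℕ) < n →
      (v : Equiv.Perm ℤ) i < (v : Equiv.Perm ℤ) (i + 1) →
      P ⟨v * simple i, mul_simple_mem v.2 i⟩ → P v)
    (v : SInf) (hv : (v : Equiv.Perm ℤ) ∈ SFin n) : P v := by
  induction hk : length ((rev n : Equiv.Perm ℤ) * v) using Nat.strong_induction_on
    generalizing v with
  | _ k ih =>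
    by_cases hne : v = rev n
    · rwa [hne]
    · obtain ⟨i, hi, h⟩ := exists_ascent hv fun h => hne (Subtype.ext h)
      refine step v i hv hi h (ih _ ?_ _ (SFin_mul hv (simple_mem_SFin hi)) rfl)
      have hp := i.pos
      have a := SFin_apply_mem hv (x := i) (by omega) (by omega)
      have b := SFin_apply_mem hv (x := i + 1) (by omega) (by omega)
      have := length_eq_length_mul_simple_add_one (w := (rev n : Equiv.Perm ℤ) * v) (i := i)
        (SInf.mul_mem (rev n).2 v.2).1 (by
          rw [Equiv.Perm.mul_apply, Equiv.Perm.mul_apply, rev_apply a.1 a.2, rev_apply b.1 b.2]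
          omega)
      rw [← hk, this, mul_assoc]
      exact Nat.lt_succ_self _

/-- The permutation `n, n - 1, …, n - k + 1, n + 1, n - k, …, 1`. -/
noncomputable def revChain (n : ℕ) : ℕ → SInf
  | 0 => rev (n + 1)
  | k + 1 => ⟨revChain n k * simple (k.succPNat : ℕ+), mul_simple_mem (revChain n k).2 _⟩

theorem revChain_apply {n k : ℕ} (hk : k ≤ n) (x : ℤ) :
    (revChain n k : Equiv.Perm ℤ) x = if 1 ≤ x ∧ x ≤ k then n + 1 - x else
      if x = k + 1 then n + 1 else if 1 ≤ x ∧ x ≤ n + 1 then n + 2 - x else x := by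
  induction k generalizing x with
  | zero =>
    change revFun (n + 1) x = _
    unfold revFun
    push_cast
    split_ifs <;> omega
  | succ k ih =>
    change (revChain n k : Equiv.Perm ℤ) (simple (k.succPNat : ℕ+) x) = _
    rw [ih (by omega)]
    have hc : ((k.succPNat : ℕ+) : ℤ) = (k : ℤ) + 1 := by simp
    rw [hc]
    push_cast
    rcases simple_cases ((k : ℤ) + 1) x with h | h | h <;>
      first | rw [h.2] | rw [h.2.2]
    all_goals split_ifs <;> omega

/-- The monomial `x₁^{n-1} ⋯ x_k^{n-k} x_{k+1}^{n-k} ⋯ x_n`. -/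
noncomputable def chainMonomial (n k : ℕ) : Poly :=
  ∏ j ∈ Finset.range (n + 1), X j.succPNat ^ (if j < k then n - 1 - j else n - j)

theorem chainMonomial_eq_mul {n k : ℕ} (hk : k < n) :
    chainMonomial n k = X k.succPNat * chainMonomial n (k + 1) := by
  unfold chainMonomial
  have hmem : k ∈ Finset.range (n + 1) := Finset.mem_range.2 (by omega)
  rw [← Finset.mul_prod_erase _ _ hmem, ← Finset.mul_prod_erase _ _ hmem, ← mul_assoc]
  congr 1
  · rw [if_neg (lt_irrefl k), if_pos (Nat.lt_succ_self k), ← pow_succ']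
    congr 1
    omega
  · refine Finset.prod_congr rfl fun j hj => ?_
    have := Finset.ne_of_mem_erase hj
    congr 1
    split_ifs <;> omega

theorem simpleAct_chainMonomial {n k : ℕ} (hk : k < n) :
    simpleAct k.succPNat (chainMonomial n (k + 1)) = chainMonomial n (k + 1) := by
  unfold chainMonomial
  have hmap : ∀ j : ℕ, simpleAct k.succPNat (X j.succPNat) =
      X (Equiv.swap k (k + 1) j).succPNat := fun j => by
    rw [simpleAct_X]
    congr 1
    have e : (k.succPNat + 1 : ℕ+) = (k + 1).succPNat := rfl
    rw [e]
    by_cases h1 : j = k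
    · subst h1; simp
    · by_cases h2 : j = k + 1
      · subst h2; simp
      · rw [Equiv.swap_apply_of_ne_of_ne h1 h2, Equiv.swap_apply_of_ne_of_ne
          (fun h => h1 (Nat.succPNat_injective h)) (fun h => h2 (Nat.succPNat_injective h))]
  unfold simpleAct at *
  rw [map_prod]
  have hsw : ∀ j, (j = k ∧ Equiv.swap k (k + 1) j = k + 1) ∨
      (j = k + 1 ∧ Equiv.swap k (k + 1) j = k) ∨
      (j ≠ k ∧ j ≠ k + 1 ∧ Equiv.swap k (k + 1) j = j) := fun j => by
    by_cases h1 : j = k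
    · left; subst h1; exact ⟨rfl, Equiv.swap_apply_left _ _⟩
    · by_cases h2 : j = k + 1
      · right; left; subst h2; exact ⟨rfl, Equiv.swap_apply_right _ _⟩
      · right; right; exact ⟨h1, h2, Equiv.swap_apply_of_ne_of_ne h1 h2⟩
  refine Finset.prod_equiv (Equiv.swap k (k + 1)) (fun j => ?_) fun j _ => ?_
  · simp only [Finset.mem_range]
    rcases hsw j with h | h | h <;> omega
  · rw [map_pow, hmap]
    congr 1
    rcases hsw j with h | h | h <;>
      first | rw [h.2] | rw [h.2.2]
    all_goals split_ifs <;> omega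

/-- This chain leads from w_{n+1} down to w_n. At each step the monomial is x_{k+1} times a monomial
symmetric in x_{k+1} and x_{k+2}, so the divided difference just deletes that factor. -/
theorem schubertIn_revChain {n k : ℕ} (hk : k ≤ n) :
    schubertIn (n + 1) (revChain n k) = chainMonomial n k := by
  induction k with
  | zero =>
    change schubertIn (n + 1) (rev (n + 1)) = _
    rw [schubertIn_rev]
    rfl
  | succ k ih =>
    have hc : ((k.succPNat : ℕ+) : ℤ) = (k : ℤ) + 1 := by simp
    have hmem : (revChain n (k + 1) : Equiv.Perm ℤ) ∈ SFin (n + 1) := fun x hx => by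
      rw [revChain_apply hk] at hx
      push_cast at hx ⊢
      split_ifs at hx <;> omega
    have hmul : (⟨revChain n (k + 1) * simple (k.succPNat : ℕ+),
        mul_simple_mem (revChain n (k + 1)).2 _⟩ : SInf) = revChain n k :=
      Subtype.ext (mul_simple_mul_simple _ _)
    rw [schubertIn_of_ascent hmem (i := k.succPNat) (by simpa using hk), hmul, ih (by omega),
      chainMonomial_eq_mul hk, dividedDiff_mul,
      dividedDiff_eq_zero_iff.2 (simpleAct_chainMonomial hk), mul_zero, add_zero,
      dividedDiff_unique (g := 1) (by rw [simpleAct_X_self, mul_one]), one_mul]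
    rw [revChain_apply hk, revChain_apply hk, hc]
    push_cast
    split_ifs <;> omega

theorem chainMonomial_self (n : ℕ) : chainMonomial n n = xDelta n := by
  unfold chainMonomial xDelta
  rw [Finset.prod_range_succ]
  rw [if_neg (lt_irrefl n), Nat.sub_self, pow_zero, mul_one]
  exact Finset.prod_congr rfl fun j hj => by rw [if_pos (Finset.mem_range.1 hj)]

/-- The end of the chain settles w_n. Below it, `schubertIn` obeys the same recursion for n and for
n + 1. -/
theorem schubertIn_succ {n : ℕ} {v : SInf} (hv : (v : Equiv.Perm ℤ) ∈ SFin n) :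
    schubertIn (n + 1) v = schubertIn n v := by
  refine SFin_induction (n := n) (P := fun v => schubertIn (n + 1) v = schubertIn n v) ?_ ?_ v hv
  · have e : rev n = revChain n n := by
      apply Subtype.ext
      ext x
      rw [revChain_apply le_rfl]
      change revFun n x = _
      unfold revFun
      split_ifs <;> omega
    rw [schubertIn_rev, e, schubertIn_revChain le_rfl, chainMonomial_self]
  · intro v i hv hi h ih
    rw [schubertIn_of_ascent hv hi h, schubertIn_of_ascent (SFin_mono (Nat.le_succ n) hv)
      (hi.trans (Nat.lt_succ_self n)) h, ih]

theorem schubertIn_eq_of_le {m n : ℕ} (h : m ≤ n) {v : SInf} (hv : (v : Equiv.Perm ℤ) ∈ SFin m) :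
    schubertIn n v = schubertIn m v := by
  induction n, h using Nat.le_induction with
  | base => rfl
  | succ n hn ih => rw [schubertIn_succ (SFin_mono hn hv), ih]

theorem schubert_eq_schubertIn {n : ℕ} {v : Equiv.Perm ℤ} (hv : v ∈ SInf) (hn : v ∈ SFin n) :
    schubert v = schubertIn n ⟨v, hv⟩ := by
  have hne : {n : ℕ | v ∈ SFin n}.Nonempty := ⟨n, hn⟩
  rw [schubert, dif_pos hv]
  exact (schubertIn_eq_of_le (v := ⟨v, hv⟩) (Nat.sInf_le hn)
    (show v ∈ SFin _ from Nat.sInf_mem hne)).symm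

theorem schubert_of_ascent {v : Equiv.Perm ℤ} (hv : v ∈ SInf) {i : ℕ+} (h : v i < v (i + 1)) :
    schubert v = dividedDiff i (schubert (v * simple i)) := by
  obtain ⟨m, hm⟩ := exists_mem_SFin hv
  have hm' : v ∈ SFin (m + i + 1) := SFin_mono (by omega) hm
  have hi : (i : ℕ) < m + i + 1 := by omega
  rw [schubert_eq_schubertIn hv hm', schubertIn_of_ascent hm' hi h,
    schubert_eq_schubertIn (mul_simple_mem hv i) (SFin_mul hm' (simple_mem_SFin hi))]

theorem dividedDiff_schubert_of_ascent {v : Equiv.Perm ℤ} (hv : v ∈ SInf) {i : ℕ+}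
    (h : v i < v (i + 1)) : dividedDiff i (schubert v) = 0 := by
  rw [schubert_of_ascent hv h, dividedDiff_dividedDiff]

theorem dividedDiff_schubert_of_descent {v : Equiv.Perm ℤ} (hv : v ∈ SInf) {i : ℕ+}
    (h : v (i + 1) < v i) : dividedDiff i (schubert v) = schubert (v * simple i) := by
  rw [schubert_of_ascent (mul_simple_mem hv i) (i := i)
    (by simpa [Equiv.Perm.mul_apply, simple_apply_left, simple_apply_right] using h),
    mul_simple_mul_simple]

/-! ### Degrees -/

/-- Homogeneity with integer degrees: in negative degree only the zero polynomial. -/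
def HomogeneousOfDegree (f : Poly) (d : ℤ) : Prop :=
  (d < 0 → f = 0) ∧ ∀ n : ℕ, d = n → f.IsHomogeneous n

theorem HomogeneousOfDegree.dividedDiff {f : Poly} {d : ℤ} (h : HomogeneousOfDegree f d)
    (i : ℕ+) : HomogeneousOfDegree (dividedDiff i f) (d - 1) := by
  refine ⟨fun hd => ?_, fun n hn => isHomogeneous_dividedDiff (h.2 (n + 1) (by push_cast; omega))⟩
  rcases lt_or_ge d 0 with h0 | h0
  · rw [h.1 h0, dividedDiff_zero]
  · exact dividedDiff_of_isHomogeneous_zero (h.2 0 (by push_cast; omega))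

theorem isHomogeneous_xDelta (n : ℕ) :
    (xDelta n).IsHomogeneous (∑ i ∈ Finset.range n, (n - 1 - i)) :=
  IsHomogeneous.prod _ _ _ fun i _ => by
    simpa using (isHomogeneous_X ℤ i.succPNat).pow (n - 1 - i)

theorem length_rev (n : ℕ) :
    length (rev n : Equiv.Perm ℤ) = ∑ i ∈ Finset.range n, (n - 1 - i) := by
  have e : inversions (rev n : Equiv.Perm ℤ) =
      (((Finset.range n).sigma fun i => Finset.range (n - 1 - i)).image
        fun c : (_ : ℕ) × ℕ => ((c.1 + 1 : ℤ), (c.1 + c.2 + 2 : ℤ)) : Finset (ℤ × ℤ)) := by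
    ext ⟨a, b⟩
    simp only [inversions, Set.mem_ofPred_eq, Finset.coe_image, Set.mem_image, Finset.mem_coe,
      Finset.mem_sigma, Finset.mem_range, Prod.mk.injEq, Sigma.exists]
    constructor
    · rintro ⟨h1, h2⟩
      change revFun n b < revFun n a at h2
      unfold revFun at h2
      refine ⟨(a - 1).toNat, (b - a - 1).toNat, ?_⟩
      split_ifs at h2 <;> omega
    · rintro ⟨c, d, h1, rfl, rfl⟩
      rw [rev_apply (by omega) (by omega), rev_apply (by omega) (by omega)]
      omega
  unfold length
  rw [e, Set.ncard_coe_finset, Finset.card_image_of_injective, Finset.card_sigma]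
  · simp
  · rintro ⟨a, b⟩ ⟨c, d⟩ h
    simp only [Prod.mk.injEq] at h
    obtain rfl : a = c := by omega
    obtain rfl : b = d := by omega
    rfl

/-- The degree of the staircase monomial equals the length of w_n; going down, ∂_i lowers the degree
by one just as the length drops by one. -/
theorem homogeneousOfDegree_schubertIn {n : ℕ} {v : SInf} (hv : (v : Equiv.Perm ℤ) ∈ SFin n) :
    HomogeneousOfDegree (schubertIn n v) (length (v : Equiv.Perm ℤ)) := by
  refine SFin_induction (n := n)
    (P := fun v => HomogeneousOfDegree (schubertIn n v) (length (v : Equiv.Perm ℤ))) ?_ ?_ v hv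
  · rw [schubertIn_rev]
    refine ⟨fun h => by omega, fun m hm => ?_⟩
    rw [length_rev] at hm
    rw [← Int.natCast_inj.1 hm]
    exact isHomogeneous_xDelta n
  · intro v i hv hi h ih
    rw [schubertIn_of_ascent hv hi h]
    have := ih.dividedDiff i
    simp only at this
    rw [length_mul_simple_of_lt v.2.1 h] at this
    simpa using this

theorem constantCoeff_schubert {v : Equiv.Perm ℤ} (hv : length v ≠ 0) :
    constantCoeff (schubert v) = 0 := by
  by_cases hm : v ∈ SInf
  · obtain ⟨n, hn⟩ := exists_mem_SFin hm
    rw [schubert_eq_schubertIn hm hn]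
    have h := (homogeneousOfDegree_schubertIn (v := ⟨v, hm⟩) hn).2 _ rfl
    by_contra h0
    rw [constantCoeff_eq] at h0
    have := h h0
    simp at this
    exact hv this.symm
  · rw [schubert, dif_neg hm, map_zero]

/-! ### Fixed-point-free involutions in `𝓕_ℤ` -/

theorem theta_cases (x : ℤ) : (∃ k, x = 2 * k ∧ theta x = 2 * k - 1) ∨
    (∃ k, x = 2 * k - 1 ∧ theta x = 2 * k) := by
  change (∃ k, x = 2 * k ∧ thetaFun x = 2 * k - 1) ∨ (∃ k, x = 2 * k - 1 ∧ thetaFun x = 2 * k)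
  unfold thetaFun
  rcases Int.even_or_odd' x with ⟨k, rfl | rfl⟩
  · exact Or.inl ⟨k, rfl, by simp⟩
  · refine Or.inr ⟨k + 1, by ring, ?_⟩
    rw [if_neg (by simp)]
    ring

theorem theta_theta (x : ℤ) : theta (theta x) = x := thetaFun_thetaFun x

theorem apply_apply_of_mem_FZ {z : Equiv.Perm ℤ} (hz : z ∈ FZ) (x : ℤ) : z (z x) = x := by
  obtain ⟨w, -, rfl⟩ := hz
  simp [Equiv.Perm.mul_apply, theta_theta]

theorem apply_ne_of_mem_FZ {z : Equiv.Perm ℤ} (hz : z ∈ FZ) (x : ℤ) : z x ≠ x := by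
  obtain ⟨w, -, rfl⟩ := hz
  intro h
  simp only [Equiv.Perm.mul_apply, Equiv.Perm.inv_eq_iff_eq] at h
  rcases theta_cases (w x) with ⟨k, h1, h2⟩ | ⟨k, h1, h2⟩ <;> omega

/-- The ends are even so that the window -2M < x ≤ 2M is a union of cycles {2k-1, 2k} of Θ, and
hence stable under z. In the choice of M, the extra 1 keeps Θ(x), not only x, outside the support of
w. -/
theorem exists_bound_of_mem_FZ {z : Equiv.Perm ℤ} (hz : z ∈ FZ) :
    ∃ M : ℤ, 0 ≤ M ∧ ∀ x, x ≤ -2 * M ∨ 2 * M < x → z x = theta x := by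
  obtain ⟨w, hw, rfl⟩ := hz
  have hw' : {x : ℤ | w x ≠ x}.Finite := hw
  obtain ⟨a, ha⟩ := hw'.bddBelow
  obtain ⟨b, hb⟩ := hw'.bddAbove
  refine ⟨|a| + |b| + 1, by positivity, fun x hx => ?_⟩
  have hfix : ∀ x, x < a ∨ b < x → w x = x := fun x hx => by
    by_contra h
    have h1 := ha h
    have h2 := hb h
    omega
  have h1 := le_abs_self b
  have h2 := neg_abs_le a
  have h3 := abs_nonneg a
  have h4 := abs_nonneg b
  have e1 : w x = x := hfix x (by omega)
  have e2 : w (theta x) = theta x := hfix _ (by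
    rcases theta_cases x with ⟨k, h1, h2⟩ | ⟨k, h1, h2⟩ <;> omega)
  rw [Equiv.Perm.mul_apply, Equiv.Perm.mul_apply, e1, Equiv.Perm.inv_eq_iff_eq, e2]

/-- Outside the stable window z is Θ, whose inversions are all cycles, so every other inversion has
both entries in the window. -/
theorem finite_inversions_diff_cycZ {z : Equiv.Perm ℤ} (hz : z ∈ FZ) :
    (inversions z \ cycZ z).Finite := by
  obtain ⟨M, hM, h⟩ := exists_bound_of_mem_FZ hz
  have hz2 := apply_apply_of_mem_FZ hz
  have key : ∀ x, (x ≤ -2 * M ∧ z x = theta x) ∨ (2 * M < x ∧ z x = theta x) ∨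
      (-2 * M < x ∧ x ≤ 2 * M ∧ -2 * M < z x ∧ z x ≤ 2 * M) := fun x => by
    have h1 := h x
    have h2 := h (z x)
    rw [hz2] at h2
    by_cases hx : x ≤ -2 * M
    · exact Or.inl ⟨hx, h1 (Or.inl hx)⟩
    · by_cases hx' : 2 * M < x
      · exact Or.inr (Or.inl ⟨hx', h1 (Or.inr hx')⟩)
      · rcases theta_cases (z x) with ⟨k, h3, h4⟩ | ⟨k, h3, h4⟩ <;> omega
  refine ((Set.finite_Icc (-2 * M) (2 * M)).prod (Set.finite_Icc (-2 * M) (2 * M))).subset ?_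
  rintro ⟨x, y⟩ ⟨⟨h1, h2⟩, h3⟩
  simp only [cycZ, Set.mem_ofPred_eq, not_and] at h1 h2 h3
  simp only [Set.mem_prod, Set.mem_Icc]
  have h3 := h3 h1.le
  rcases key x with hx | hx | hx <;> rcases key y with hy | hy | hy <;>
    rcases theta_cases x with ⟨k, h4, h5⟩ | ⟨k, h4, h5⟩ <;>
    rcases theta_cases y with ⟨l, h6, h7⟩ | ⟨l, h6, h7⟩ <;> omega

/-- The conjugate of `z` by the transposition `(a, b)`. -/
def conjSwap (a b : ℤ) (z : Equiv.Perm ℤ) : Equiv.Perm ℤ :=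
  Equiv.swap a b * z * Equiv.swap a b

theorem conjSwap_apply (a b : ℤ) (z : Equiv.Perm ℤ) (x : ℤ) :
    conjSwap a b z x = Equiv.swap a b (z (Equiv.swap a b x)) := rfl

theorem conjSwap_comm (a b : ℤ) (z : Equiv.Perm ℤ) : conjSwap a b z = conjSwap b a z := by
  rw [conjSwap, Equiv.swap_comm, ← conjSwap]

theorem conjSwap_conjSwap (a b : ℤ) (z : Equiv.Perm ℤ) :
    conjSwap a b (conjSwap a b z) = z := by
  ext x
  simp [conjSwap_apply]

theorem swap_mem_SZ (a b : ℤ) : Equiv.swap a b ∈ SZ :=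
  (Set.toFinite {a, b}).subset fun x hx => by
    by_contra h
    simp only [Set.mem_insert_iff, Set.mem_singleton_iff, not_or] at h
    exact hx (Equiv.swap_apply_of_ne_of_ne h.1 h.2)

theorem conjSwap_mem {z : Equiv.Perm ℤ} (hz : z ∈ FZ) (a b : ℤ) : conjSwap a b z ∈ FZ := by
  obtain ⟨w, hw, rfl⟩ := hz
  refine ⟨w * Equiv.swap a b, SZ.mul_mem hw (swap_mem_SZ a b), ?_⟩
  simp only [conjSwap, mul_inv_rev, Equiv.swap_inv, mul_assoc]

theorem conjSwap_eq_self {z : Equiv.Perm ℤ} (hz : z ∈ FZ) {a b : ℤ} (h : z a = b) :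
    conjSwap a b z = z := by
  have h2 := apply_apply_of_mem_FZ hz
  have hb : z b = a := by rw [← h, h2]
  ext x
  rw [conjSwap_apply]
  by_cases h1 : x = a
  · rw [h1, Equiv.swap_apply_left, hb, Equiv.swap_apply_left, h]
  · by_cases h3 : x = b
    · rw [h3, Equiv.swap_apply_right, h, Equiv.swap_apply_right, hb]
    · rw [Equiv.swap_apply_of_ne_of_ne h1 h3, Equiv.swap_apply_of_ne_of_ne]
      · exact fun h4 => h3 (by rw [← h4, h2] at h; exact h)
      · exact fun h4 => h1 (by rw [← h4, h2] at hb; exact hb)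

theorem conjSwap_simple_conj (i a b : ℤ) (z : Equiv.Perm ℤ) :
    conjSwap i (i + 1) (conjSwap a b (conjSwap i (i + 1) z)) =
      conjSwap (simple i a) (simple i b) z := by
  have e : Equiv.swap (simple i a) (simple i b) = simple i * Equiv.swap a b * simple i := by
    rw [Equiv.swap_apply_apply, simple_inv]
  simp only [conjSwap, e]
  simp only [simple, mul_assoc]

theorem conjSwap_simple_apply (i : ℤ) (z : Equiv.Perm ℤ) (x : ℤ) :
    conjSwap i (i + 1) z x = simple i (z (simple i x)) := rfl

theorem swap_cases (a b x : ℤ) : (x = a ∧ Equiv.swap a b x = b) ∨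
    (x = b ∧ Equiv.swap a b x = a) ∨ (x ≠ a ∧ x ≠ b ∧ Equiv.swap a b x = x) := by
  by_cases h1 : x = a
  · left; subst h1; exact ⟨rfl, Equiv.swap_apply_left _ _⟩
  · by_cases h2 : x = b
    · right; left; subst h2; exact ⟨rfl, Equiv.swap_apply_right _ _⟩
    · right; right; exact ⟨h1, h2, Equiv.swap_apply_of_ne_of_ne h1 h2⟩

/-! ### The length function on `𝓕_ℤ` -/

/-- Up to relabelling by s_i, exactly two non-cycle inversions appear, (i, i+1) and (z i, z(i+1));
the factor 1/2 in the length turns this into 1. -/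
theorem fpfLength_conjSwap_of_ascent {z : Equiv.Perm ℤ} (hz : z ∈ FZ) {i : ℤ}
    (h : z i < z (i + 1)) : fpfLength (conjSwap i (i + 1) z) = fpfLength z + 1 := by
  have hz2 := apply_apply_of_mem_FZ hz
  have hne := apply_ne_of_mem_FZ hz
  have n1 := hne i
  have n2 := hne (i + 1)
  have n3 : z i ≠ i + 1 := fun h' => by have := hz2 i; rw [h'] at this; omega
  have n4 : z (i + 1) ≠ i := fun h' => by have := hz2 (i + 1); rw [h'] at this; omega
  have eq_i : ∀ x, z x = i → x = z i := fun x hx => by rw [← hx, hz2]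
  have eq_i' : ∀ x, z x = i + 1 → x = z (i + 1) := fun x hx => by rw [← hx, hz2]
  have si := simple_apply_left i
  have si' := simple_apply_right i
  have sz := simple_apply_of_ne n1 n3
  have sz' := simple_apply_of_ne n4 n2
  have hinj : Function.Injective (Prod.map (simple i) (simple i)) :=
    (simple i).injective.prodMap (simple i).injective
  have heq : inversions (conjSwap i (i + 1) z) \ cycZ (conjSwap i (i + 1) z) =
      insert (i, i + 1) (insert (z i, z (i + 1))
        (Prod.map (simple i) (simple i) '' (inversions z \ cycZ z))) := by
    ext ⟨a, b⟩
    simp only [Set.mem_insert_iff, Set.mem_image, Prod.mk.injEq, inversions, cycZ, Set.mem_sdiff,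
      Set.mem_ofPred_eq, conjSwap_simple_apply, Prod.exists, Prod.map_apply]
    constructor
    · rintro ⟨⟨h1, h2⟩, h3⟩
      by_cases hab : a = i ∧ b = i + 1
      · exact Or.inl hab
      by_cases hab' : a = z i ∧ b = z (i + 1)
      · exact Or.inr (Or.inl hab')
      refine Or.inr (Or.inr ⟨simple i a, simple i b, ⟨⟨?_, ?_⟩, ?_⟩, simple_simple _ _,
        simple_simple _ _⟩)
      · rcases simple_cases i a with ha | ha | ha <;>
          rcases simple_cases i b with hb | hb | hb <;> omega
      · have ea := eq_i (simple i a)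
        have eb := eq_i' (simple i b)
        have ea' : simple i a = z i → a = z i := fun h => by
          rw [← simple_simple i a, h, sz]
        have eb' : simple i b = z (i + 1) → b = z (i + 1) := fun h => by
          rw [← simple_simple i b, h, sz']
        have hinj : z (simple i a) = z (simple i b) → a = b := fun h =>
          (simple i).injective (z.injective h)
        rcases simple_cases i (z (simple i a)) with ha | ha | ha <;>
          rcases simple_cases i (z (simple i b)) with hb | hb | hb <;> omega
      · rintro ⟨_, h4⟩
        exact h3 ⟨h1.le, by rw [← h4, simple_simple]⟩
    · rintro (⟨rfl, rfl⟩ | ⟨rfl, rfl⟩ | ⟨c, d, ⟨⟨h1, h2⟩, h3⟩, rfl, rfl⟩)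
      · rw [si, si', sz, sz']
        omega
      · rw [sz, sz', hz2, hz2, si, si']
        omega
      · rw [simple_simple, simple_simple]
        have ec := eq_i' c
        have ed := eq_i d
        refine ⟨⟨?_, ?_⟩, ?_⟩
        · by_cases hcd : c = i ∧ d = i + 1
          · obtain ⟨rfl, rfl⟩ := hcd
            omega
          · rcases simple_cases i c with ha | ha | ha <;>
              rcases simple_cases i d with hb | hb | hb <;> omega
        · rcases simple_cases i (z c) with ha | ha | ha <;>
            rcases simple_cases i (z d) with hb | hb | hb <;> omega
        · rintro ⟨_, h4⟩
          exact h3 ⟨h1.le, (simple i).injective h4⟩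
  have hfin := (finite_inversions_diff_cycZ hz).image (Prod.map (simple i) (simple i))
  have hnot : (z i, z (i + 1)) ∉
      Prod.map (simple i) (simple i) '' (inversions z \ cycZ z) := by
    rintro ⟨⟨c, d⟩, ⟨⟨h1, h2⟩, h3⟩, h4⟩
    simp only [Prod.map_apply, Prod.mk.injEq] at h1 h2 h4
    have hc : c = z i := by rw [← simple_simple i c, h4.1, sz]
    have hd : d = z (i + 1) := by rw [← simple_simple i d, h4.2, sz']
    rw [hc, hd, hz2, hz2] at h2
    omega
  have hnot' : (i, i + 1) ∉ insert (z i, z (i + 1))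
      (Prod.map (simple i) (simple i) '' (inversions z \ cycZ z)) := by
    rintro (h4 | ⟨⟨c, d⟩, ⟨⟨h1, h2⟩, h3⟩, h4⟩)
    · simp only [Prod.mk.injEq] at h4
      omega
    · simp only [Prod.map_apply, Prod.mk.injEq] at h1 h2 h4
      have hc : c = i + 1 := by rw [← simple_simple i c, h4.1, si]
      have hd : d = i := by rw [← simple_simple i d, h4.2, si']
      omega
  unfold fpfLength
  rw [heq, Set.ncard_insert_of_notMem hnot' (hfin.insert _), Set.ncard_insert_of_notMem hnot hfin,
    Set.ncard_image_of_injective _ hinj]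
  omega

theorem fpfLength_conjSwap_of_descent {z : Equiv.Perm ℤ} (hz : z ∈ FZ) {i : ℤ}
    (h : z (i + 1) < z i) (h' : z i ≠ i + 1) :
    fpfLength z = fpfLength (conjSwap i (i + 1) z) + 1 := by
  have hz2 := apply_apply_of_mem_FZ hz
  have hne := apply_ne_of_mem_FZ hz
  have n4 : z (i + 1) ≠ i := fun h'' => h' (by have := hz2 (i + 1); rwa [h''] at this)
  have := fpfLength_conjSwap_of_ascent (conjSwap_mem hz i (i + 1)) (i := i) (by
    rw [conjSwap_simple_apply, conjSwap_simple_apply, simple_apply_left, simple_apply_right,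
      simple_apply_of_ne n4 (hne _), simple_apply_of_ne (hne _) h']
    exact h)
  rwa [conjSwap_conjSwap] at this

theorem simple_trichotomy (z : Equiv.Perm ℤ) (i : ℤ) :
    z i < z (i + 1) ∨ (z (i + 1) < z i ∧ z i ≠ i + 1) ∨ z i = i + 1 := by
  have := apply_ne_apply_succ z i
  omega

theorem fpfLength_conjSwap_simple_le {z : Equiv.Perm ℤ} (hz : z ∈ FZ) (i : ℤ) :
    fpfLength (conjSwap i (i + 1) z) ≤ fpfLength z + 1 ∧
      fpfLength z ≤ fpfLength (conjSwap i (i + 1) z) + 1 := by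
  rcases simple_trichotomy z i with h | h | h
  · have := fpfLength_conjSwap_of_ascent hz h
    omega
  · have := fpfLength_conjSwap_of_descent hz h.1 h.2
    omega
  · rw [conjSwap_eq_self hz h]
    omega

/-- When z a ≠ b the transpositions (a, b) and (z a, z b) are disjoint, and z conjugates one into
the other. This symmetry between positions and values is used to move to a more convenient pair. -/
theorem conjSwap_eq_conjSwap_apply {z : Equiv.Perm ℤ} (hz : z ∈ FZ) {a b : ℤ} (hab : a ≠ b) :
    conjSwap a b z = conjSwap (z a) (z b) z := by
  have hz2 := apply_apply_of_mem_FZ hz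
  have hne := apply_ne_of_mem_FZ hz
  by_cases h : z a = b
  · rw [conjSwap_eq_self hz h, conjSwap_eq_self hz (by rw [hz2, ← h, hz2])]
  · have h' : z b ≠ a := fun h'' => h (by rw [← h'', hz2])
    have hd : Equiv.swap a b * Equiv.swap (z a) (z b) =
        Equiv.swap (z a) (z b) * Equiv.swap a b := by
      refine (Equiv.Perm.disjoint_swap_swap ?_).commute
      have := hne a
      have := hne b
      have := z.injective.ne hab
      simp only [List.nodup_cons, List.mem_cons, List.not_mem_nil, or_false, not_or,
        not_false_eq_true, List.nodup_nil, and_true]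
      omega
    have hc : z * Equiv.swap a b = Equiv.swap (z a) (z b) * z := by
      rw [Equiv.swap_apply_apply, inv_mul_cancel_right]
    have hc' : z * Equiv.swap (z a) (z b) = Equiv.swap a b * z := by
      have := Equiv.swap_apply_apply z (z a) (z b)
      rw [hz2, hz2] at this
      rw [this, inv_mul_cancel_right]
    unfold conjSwap
    rw [mul_assoc, hc, mul_assoc, hc', ← mul_assoc, ← mul_assoc, hd]

/-- Induction on b - a through (a, b) = s_a (a+1, b) s_a. The middle conjugation raises the length
by induction, and a possible loss at one outer step is compensated by a gain at the other. -/
theorem fpfLength_lt_conjSwap {z : Equiv.Perm ℤ} (hz : z ∈ FZ) {a b : ℤ} (hab : a < b)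
    (h : z a < z b) : fpfLength z < fpfLength (conjSwap a b z) := by
  induction hn : (b - a).toNat using Nat.strong_induction_on generalizing z a b with
  | _ n ih =>
    have hz2 := apply_apply_of_mem_FZ hz
    have hne := apply_ne_of_mem_FZ hz
    rcases eq_or_lt_of_le (show a + 1 ≤ b from hab) with rfl | hab'
    · rw [fpfLength_conjSwap_of_ascent hz h]
      exact Nat.lt_succ_self _
    have hy := conjSwap_mem hz a (a + 1)
    have hz' := conjSwap_mem hy (a + 1) b
    have hZ := conjSwap_mem hz a b
    have e : conjSwap a (a + 1) (conjSwap (a + 1) b (conjSwap a (a + 1) z)) = conjSwap a b z := by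
      rw [conjSwap_simple_conj, simple_apply_right, simple_apply_of_ne (by omega) (by omega)]
    have e' : conjSwap a (a + 1) (conjSwap a b z) =
        conjSwap (a + 1) b (conjSwap a (a + 1) z) := by
      rw [← e, conjSwap_conjSwap]
    have na := hne a
    have nb := hne b
    have ha1 : z a = a + 1 → z (a + 1) = a := fun h' => by rw [← h', hz2]
    have hb1 : z b = a + 1 → z (a + 1) = b := fun h' => by rw [← h', hz2]
    have hba : z b = a → z a = b := fun h' => by rw [← h', hz2]
    have inj1 : z (a + 1) ≠ z b := fun h' => by have := z.injective h'; omega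
    have hlt := ih _ (by omega) hy hab' (by
      rw [conjSwap_simple_apply, conjSwap_simple_apply, simple_apply_right,
        simple_apply_of_ne (x := b) (by omega) (by omega)]
      rcases simple_cases a (z a) with h1 | h1 | h1 <;>
        rcases simple_cases a (z b) with h2 | h2 | h2 <;> omega) rfl
    have hZa : conjSwap a b z a = Equiv.swap a b (z b) := by
      rw [conjSwap_apply, Equiv.swap_apply_left]
    have hZa' : conjSwap a b z (a + 1) = Equiv.swap a b (z (a + 1)) := by
      rw [conjSwap_apply, Equiv.swap_apply_of_ne_of_ne (x := a + 1) (by omega) (by omega)]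
    have hdesc : conjSwap a b z (a + 1) < conjSwap a b z a → conjSwap a b z a ≠ a + 1 →
        fpfLength z < fpfLength (conjSwap a b z) := fun h1 h2 => by
      have := fpfLength_conjSwap_of_descent hZ h1 h2
      rw [e'] at this
      have := (fpfLength_conjSwap_simple_le hz a).2
      omega
    rw [hZa, hZa'] at hdesc
    have hz1b : z (a + 1) = b → z b = a + 1 := fun h' => by rw [← h', hz2]
    have hz1a : z (a + 1) = a → z a = a + 1 := fun h' => by
      have := hz2 (a + 1)
      rwa [h'] at this
    rcases simple_trichotomy z a with h1 | h1 | h1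
    · have h2 := fpfLength_conjSwap_of_ascent hz h1
      have h3 := (fpfLength_conjSwap_simple_le hz' a).2
      rw [e] at h3
      omega
    · apply hdesc <;>
      rcases swap_cases a b (z b) with h2 | h2 | h2 <;>
        rcases swap_cases a b (z (a + 1)) with h3 | h3 | h3 <;> omega
    · by_cases hlt' : b < z b
      · apply hdesc <;>
        rcases swap_cases a b (z b) with h2 | h2 | h2 <;>
          rcases swap_cases a b (z (a + 1)) with h3 | h3 | h3 <;> omega
      -- Here z a = a + 1 and z b < b, so the pair (z a, z b) is closer together than (a, b).
      · rw [conjSwap_eq_conjSwap_apply hz hab.ne, h1]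
        exact ih _ (by omega) hz (by omega) (by rw [hz2, ← h1, hz2]; omega) rfl

theorem fpfLength_conjSwap_lt {z : Equiv.Perm ℤ} (hz : z ∈ FZ) {a b : ℤ} (hab : a < b)
    (h : z b < z a) (h' : z a ≠ b) : fpfLength (conjSwap a b z) < fpfLength z := by
  have hz2 := apply_apply_of_mem_FZ hz
  have hne := apply_ne_of_mem_FZ hz
  have hb : z b ≠ a := fun h'' => h' (by rw [← h'', hz2])
  have := fpfLength_lt_conjSwap (conjSwap_mem hz a b) hab (by
    rw [conjSwap_apply, conjSwap_apply, Equiv.swap_apply_left, Equiv.swap_apply_right,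
      Equiv.swap_apply_of_ne_of_ne hb (hne b), Equiv.swap_apply_of_ne_of_ne (hne a) h']
    exact h)
  rwa [conjSwap_conjSwap] at this

theorem fpfLength_lt_conjSwap_iff {z : Equiv.Perm ℤ} (hz : z ∈ FZ) {a b : ℤ} (hab : a < b) :
    fpfLength z < fpfLength (conjSwap a b z) ↔ z a < z b := by
  refine ⟨fun h => ?_, fpfLength_lt_conjSwap hz hab⟩
  by_contra h1
  by_cases h2 : z a = b
  · rw [conjSwap_eq_self hz h2] at h
    exact lt_irrefl _ h
  · have := z.injective.ne hab.ne
    have := fpfLength_conjSwap_lt hz hab (by omega) h2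
    omega

/-! ### Covers in the Bruhat order on `𝓕_ℤ` -/

/-- No `k` strictly between `a` and `b` has its value strictly between those of `a` and `b`. -/
def NoBetween (z : Equiv.Perm ℤ) (a b : ℤ) : Prop :=
  ∀ k, a < k → k < b → z a < z k → ¬ z k < z b

/-- By the betweenness condition, z(a+1) lies on the same side of z a and of z b. Conjugation by s_a
therefore changes the lengths of z and of its conjugate by the same amount, and the pair can shrink
to (a+1, b). -/
theorem fpfLength_conjSwap_of_noBetween_aux {z : Equiv.Perm ℤ} (hz : z ∈ FZ) {a b : ℤ}
    (hab : a < b) (h : z a < z b) (ha : z a < a) (hb : z b < a ∨ b < z b)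
    (hk : NoBetween z a b) : fpfLength (conjSwap a b z) = fpfLength z + 1 := by
  induction hn : (b - a).toNat using Nat.strong_induction_on generalizing z a b with
  | _ n ih =>
    have hz2 := apply_apply_of_mem_FZ hz
    have hne := apply_ne_of_mem_FZ hz
    rcases eq_or_lt_of_le (show a + 1 ≤ b from hab) with rfl | hab'
    · rw [fpfLength_conjSwap_of_ascent hz h]
    have hy := conjSwap_mem hz a (a + 1)
    have hz' := conjSwap_mem hy (a + 1) b
    have hZ := conjSwap_mem hz a b
    have e : conjSwap a (a + 1) (conjSwap a b z) =
        conjSwap (a + 1) b (conjSwap a (a + 1) z) := by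
      rw [← conjSwap_conjSwap a (a + 1) (conjSwap (a + 1) b _), conjSwap_simple_conj,
        simple_apply_right, simple_apply_of_ne (by omega) (by omega)]
    have nb := hne b
    have hb1 : z b = a + 1 → z (a + 1) = b := fun h' => by rw [← h', hz2]
    have hb0 : z b = a → z a = b := fun h' => by rw [← h', hz2]
    have h1b : z (a + 1) = b → z b = a + 1 := fun h' => by rw [← h', hz2]
    have h1a : z (a + 1) = a → z a = a + 1 := fun h' => by
      have := hz2 (a + 1)
      rwa [h'] at this
    have inj1 : z (a + 1) ≠ z b := fun h' => by have := z.injective h'; omega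
    have inj2 : z (a + 1) ≠ z a := fun h' => by have := z.injective h'; omega
    have hk1 := hk (a + 1) (by omega) hab'
    have ea : conjSwap a (a + 1) z (a + 1) = z a := by
      rw [conjSwap_simple_apply, simple_apply_right, simple_apply_of_ne (by omega) (by omega)]
    have eb : conjSwap a (a + 1) z b = z b := by
      rw [conjSwap_simple_apply, simple_apply_of_ne (x := b) (by omega) (by omega),
        simple_apply_of_ne (by omega) (by omega)]
    have hrec := ih _ (by omega) hy hab' (by rw [ea, eb]; exact h) (by rw [ea]; omega)
      (by rw [eb]; omega) (fun k h1 h2 => by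
        rw [ea, eb, conjSwap_simple_apply, simple_apply_of_ne (x := k) (by omega) (by omega)]
        have := hk k (by omega) h2
        have hka : z k = a → z a = k := fun h' => by rw [← h', hz2]
        have hka' : z k = a + 1 → z (a + 1) = k := fun h' => by rw [← h', hz2]
        rcases simple_cases a (z k) with h3 | h3 | h3 <;> omega) rfl
    rw [← e] at hrec
    have hZa : conjSwap a b z a = z b := by
      rw [conjSwap_apply, Equiv.swap_apply_left, Equiv.swap_apply_of_ne_of_ne (by omega) nb]
    have hZa' : conjSwap a b z (a + 1) = z (a + 1) := by
      rw [conjSwap_apply, Equiv.swap_apply_of_ne_of_ne (x := a + 1) (by omega) (by omega),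
        Equiv.swap_apply_of_ne_of_ne (by omega) (by omega)]
    rcases lt_or_gt_of_ne inj2 with h1 | h1
    · have h2 := fpfLength_conjSwap_of_descent hz h1 (by omega)
      have h3 := fpfLength_conjSwap_of_descent hZ (i := a) (by rw [hZa, hZa']; omega)
        (by rw [hZa]; omega)
      omega
    · have h2 := fpfLength_conjSwap_of_ascent hz h1
      have h3 := fpfLength_conjSwap_of_ascent hZ (i := a) (by rw [hZa, hZa']; omega)
      omega

/-- The two excluded patterns are those where two side-by-side arcs of z become nested, which costs
more than one step. If z a > a, passing to (z a, z b) reduces to the auxiliary case. -/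
theorem fpfLength_conjSwap_of_noBetween {z : Equiv.Perm ℤ} (hz : z ∈ FZ) {a b : ℤ}
    (hab : a < b) (h : z a < z b) (h1 : ¬ (a < z a ∧ z a < b ∧ b < z b))
    (h2 : ¬ (z a < a ∧ a < z b ∧ z b < b)) (hk : NoBetween z a b) :
    fpfLength (conjSwap a b z) = fpfLength z + 1 := by
  have hz2 := apply_apply_of_mem_FZ hz
  have na := apply_ne_of_mem_FZ hz a
  have nb := apply_ne_of_mem_FZ hz b
  have hab0 : z a = b → z b = a := fun h' => by rw [← h', hz2]
  have hba0 : z b = a → z a = b := fun h' => by rw [← h', hz2]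
  by_cases ha : z a < a
  · exact fpfLength_conjSwap_of_noBetween_aux hz hab h ha (by omega) hk
  · rw [conjSwap_eq_conjSwap_apply hz hab.ne]
    refine fpfLength_conjSwap_of_noBetween_aux hz h (by rwa [hz2, hz2]) (by rw [hz2]; omega)
      (by rw [hz2]; omega) fun k h3 h4 => ?_
    rw [hz2, hz2]
    intro h5 h6
    exact hk (z k) h5 h6 (by rwa [hz2]) (by rwa [hz2])

theorem fpfStep_conjSwap {z : Equiv.Perm ℤ} (hz : z ∈ FZ) {a b : ℤ} (hab : a < b)
    (h : z a < z b) : FPFStep z (conjSwap a b z) :=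
  ⟨a, b, hab.ne, rfl, fpfLength_lt_conjSwap hz hab h⟩

theorem fpfLength_le_of_fpfLe {y z : Equiv.Perm ℤ} (h : FPFLe y z) :
    fpfLength y < fpfLength z ∨ y = z := by
  induction h with
  | refl => exact Or.inr rfl
  | tail _ h ih =>
    obtain ⟨i, j, -, -, h⟩ := h
    rcases ih with ih | rfl
    · exact Or.inl (ih.trans h)
    · exact Or.inl h

/-- The identity (k, b)(a, b)(a, k) = (a, b) splits the conjugation into three, each of which raises
the length. -/
theorem conjSwap_chain {z : Equiv.Perm ℤ} (hz : z ∈ FZ) {a b k : ℤ} (h1 : a < k) (h2 : k < b)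
    (h3 : z a < z k) (h4 : z k < z b) :
    FPFStep z (conjSwap a k z) ∧ FPFStep (conjSwap a k z) (conjSwap a b (conjSwap a k z)) ∧
      FPFStep (conjSwap a b (conjSwap a k z)) (conjSwap a b z) := by
  have hz2 := apply_apply_of_mem_FZ hz
  have hne := apply_ne_of_mem_FZ hz
  have na := hne a
  have nb := hne b
  have nk := hne k
  have ak : z a = k → z k = a := fun h' => by rw [← h', hz2]
  have ka : z k = a → z a = k := fun h' => by rw [← h', hz2]
  have bk : z b = k → z k = b := fun h' => by rw [← h', hz2]
  have kb : z k = b → z b = k := fun h' => by rw [← h', hz2]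
  have ba : z b = a → z a = b := fun h' => by rw [← h', hz2]
  have ab : z a = b → z b = a := fun h' => by rw [← h', hz2]
  set y := conjSwap a k z with hy
  have my : y ∈ FZ := conjSwap_mem hz a k
  have ya : y a = z k := by
    rw [hy, conjSwap_apply, Equiv.swap_apply_left,
      Equiv.swap_apply_of_ne_of_ne (by omega) (by omega)]
  have yk : y k = z a := by
    rw [hy, conjSwap_apply, Equiv.swap_apply_right,
      Equiv.swap_apply_of_ne_of_ne (by omega) (by omega)]
  have yb : y b = z b := by
    rw [hy, conjSwap_apply, Equiv.swap_apply_of_ne_of_ne (x := b) (by omega) (by omega),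
      Equiv.swap_apply_of_ne_of_ne (by omega) (by omega)]
  set x := conjSwap a b y with hx
  have mx : x ∈ FZ := conjSwap_mem my a b
  have xb : x b = z k := by
    rw [hx, conjSwap_apply, Equiv.swap_apply_right, ya,
      Equiv.swap_apply_of_ne_of_ne (by omega) (by omega)]
  have xk : x k = z a := by
    rw [hx, conjSwap_apply, Equiv.swap_apply_of_ne_of_ne (x := k) (by omega) (by omega), yk,
      Equiv.swap_apply_of_ne_of_ne (by omega) (by omega)]
  have e : conjSwap k b x = conjSwap a b z := by
    have : Equiv.swap k b * Equiv.swap a b * Equiv.swap a k = Equiv.swap a b := by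
      ext t
      simp only [Equiv.Perm.mul_apply, Equiv.swap_apply_def]
      split_ifs <;> omega
    have this' : Equiv.swap a k * Equiv.swap a b * Equiv.swap k b = Equiv.swap a b := by
      have := congrArg (·⁻¹) this
      simpa [mul_assoc] using this
    rw [hx, hy]
    calc conjSwap k b (conjSwap a b (conjSwap a k z))
        = (Equiv.swap k b * Equiv.swap a b * Equiv.swap a k) * z *
          (Equiv.swap a k * Equiv.swap a b * Equiv.swap k b) := by
          simp only [conjSwap, mul_assoc]
      _ = conjSwap a b z := by rw [this, this', conjSwap]
  refine ⟨fpfStep_conjSwap hz h1 h3, fpfStep_conjSwap my (by omega) (by omega), ?_⟩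
  rw [← e]
  exact fpfStep_conjSwap mx (by omega) (by omega)

theorem fpfLength_add_three_le {z : Equiv.Perm ℤ} (hz : z ∈ FZ) {a b k : ℤ} (h1 : a < k)
    (h2 : k < b) (h3 : z a < z k) (h4 : z k < z b) :
    fpfLength z + 3 ≤ fpfLength (conjSwap a b z) := by
  obtain ⟨⟨_, _, _, _, s1⟩, ⟨_, _, _, _, s2⟩, ⟨_, _, _, _, s3⟩⟩ := conjSwap_chain hz h1 h2 h3 h4
  omega

/-- Two side-by-side arcs first become crossing and then nested. -/
theorem conjSwap_chain_of_noncrossing {z : Equiv.Perm ℤ} (hz : z ∈ FZ) {a b : ℤ}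
    (h1 : z a < a) (h2 : a < z b) (h3 : z b < b) :
    FPFStep z (conjSwap a (z b) z) ∧ FPFStep (conjSwap a (z b) z) (conjSwap a b z) := by
  have hz2 := apply_apply_of_mem_FZ hz
  have my := conjSwap_mem hz a (z b)
  have e : conjSwap (z b) b (conjSwap a (z b) z) = conjSwap a b z := by
    have sl : ∀ x y : ℤ, Equiv.swap x y x = y := Equiv.swap_apply_left
    have sr : ∀ x y : ℤ, Equiv.swap x y y = x := Equiv.swap_apply_right
    have sn : ∀ {x y t : ℤ}, t ≠ x → t ≠ y → Equiv.swap x y t = t :=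
      fun h h' => Equiv.swap_apply_of_ne_of_ne h h'
    ext t
    simp only [conjSwap_apply]
    by_cases ta : t = a
    · rw [ta, sn (t := a) (by omega) (by omega), sl, sl, hz2, sn (t := b) (by omega) (by omega),
        sr, sn (t := z b) (by omega) (by omega)]
    by_cases tb : t = b
    · rw [tb, sr, sr, sr, sn (t := z a) (by omega) (by omega),
        sn (t := z a) (by omega) (by omega), sn (t := z a) (by omega) (by omega)]
    by_cases tza : t = z a
    · rw [tza, sn (t := z a) (by omega) (by omega), sn (t := z a) (by omega) (by omega), hz2,
        sl, sl, sn (t := z a) (by omega) (by omega), hz2, sl]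
    by_cases tzb : t = z b
    · rw [tzb, sl, sn (t := b) (by omega) (by omega), sr, sn (t := a) (by omega) (by omega),
        sn (t := z b) (by omega) (by omega), hz2, sr]
    have n1 : z t ≠ a := fun h => tza (by rw [← h, hz2])
    have n2 : z t ≠ b := fun h => tzb (by rw [← h, hz2])
    have n3 : z t ≠ z b := z.injective.ne tb
    rw [sn tzb tb, sn ta tzb, sn n1 n3, sn n3 n2, sn ta tb, sn n1 n2]
  refine ⟨fpfStep_conjSwap hz h2 (by rw [hz2]; omega), ?_⟩
  rw [← e]
  refine fpfStep_conjSwap my h3 ?_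
  rw [conjSwap_apply, conjSwap_apply, Equiv.swap_apply_right,
    Equiv.swap_apply_of_ne_of_ne (x := z a) (by omega) (by omega),
    Equiv.swap_apply_of_ne_of_ne (x := b) (by omega) (by omega), Equiv.swap_apply_right]
  exact h1

/-- If one of the conditions for a length increase of 1 fails, the chains above exhibit an element
strictly in between. Conversely the length is strictly increasing along the order, so an increase of
1 leaves no room. -/
theorem fpfCovers_conjSwap_iff {z : Equiv.Perm ℤ} (hz : z ∈ FZ) {a b : ℤ} (hab : a < b)
    (h : z a < z b) :
    FPFCovers z (conjSwap a b z) ↔ fpfLength (conjSwap a b z) = fpfLength z + 1 := by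
  have hz2 := apply_apply_of_mem_FZ hz
  constructor
  · intro hc
    have key : ∀ w ∈ FZ, FPFStep z w → FPFLe w (conjSwap a b z) →
        fpfLength w < fpfLength (conjSwap a b z) → False := fun w hw h1 h2 h3 => by
      have : w ∈ ({z} : Set _) := by
        rw [← hc]
        exact ⟨hw, Relation.ReflTransGen.single h1, h2, fun h => by rw [h] at h3; omega⟩
      rw [Set.mem_singleton_iff.1 this] at h1
      obtain ⟨_, _, _, _, h4⟩ := h1
      omega
    have key2 : ∀ w ∈ FZ, FPFStep z w → FPFStep w (conjSwap a b z) → False :=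
      fun w hw h1 h2 => key w hw h1 (Relation.ReflTransGen.single h2) (by
        obtain ⟨_, _, _, _, h4⟩ := h2
        exact h4)
    apply fpfLength_conjSwap_of_noBetween hz hab h
    · rintro ⟨h1, h2, h3⟩
      have := conjSwap_chain_of_noncrossing hz (a := z a) (b := z b) (by rwa [hz2])
        (by rwa [hz2]) (by rwa [hz2])
      rw [hz2, ← conjSwap_eq_conjSwap_apply hz hab.ne] at this
      exact key2 _ (conjSwap_mem hz _ _) this.1 this.2
    · rintro ⟨h1, h2, h3⟩
      have := conjSwap_chain_of_noncrossing hz h1 h2 h3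
      exact key2 _ (conjSwap_mem hz _ _) this.1 this.2
    · intro k h1 h2 h3 h4
      obtain ⟨s1, s2, s3⟩ := conjSwap_chain hz h1 h2 h3 h4
      refine key _ (conjSwap_mem hz _ _) s1 ((Relation.ReflTransGen.single s2).tail s3) ?_
      obtain ⟨_, _, _, _, t2⟩ := s2
      obtain ⟨_, _, _, _, t3⟩ := s3
      omega
  · intro hl
    have hstep := fpfStep_conjSwap hz hab h
    ext w
    constructor
    · rintro ⟨hw, h1, h2, h3⟩
      rcases fpfLength_le_of_fpfLe h1 with h1 | h1
      · rcases fpfLength_le_of_fpfLe h2 with h2 | h2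
        · omega
        · exact absurd h2 h3
      · exact h1.symm
    · rintro rfl
      exact ⟨hz, Relation.ReflTransGen.refl, Relation.ReflTransGen.single hstep, fun h => by
        rw [← h] at hl; omega⟩

theorem lt_apply_of_fpfCovers {z : Equiv.Perm ℤ} (hz : z ∈ FZ) {a b : ℤ} (hab : a < b)
    (h : FPFCovers z (conjSwap a b z)) : z a < z b := by
  have h1 : z ∈ {w | w ∈ FZ ∧ FPFLe z w ∧ FPFLt w (conjSwap a b z)} := by
    rw [show {w | w ∈ FZ ∧ FPFLe z w ∧ FPFLt w (conjSwap a b z)} = {z} from h]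
    rfl
  obtain ⟨-, -, h2, h3⟩ := h1
  rw [← fpfLength_lt_conjSwap_iff hz hab]
  exact (fpfLength_le_of_fpfLe h2).resolve_right h3

theorem mem_psiPlus_iff {y z : Equiv.Perm ℤ} (hy : y ∈ FZ) {r : ℤ} :
    z ∈ psiPlus y r ↔
      ∃ j, r < j ∧ z = conjSwap r j y ∧ fpfLength z = fpfLength y + 1 := by
  constructor
  · rintro ⟨-, h2, j, h3, rfl⟩
    exact ⟨j, h3, rfl, (fpfCovers_conjSwap_iff hy h3 (lt_apply_of_fpfCovers hy h3 h2)).1 h2⟩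
  · rintro ⟨j, h1, rfl, h2⟩
    exact ⟨conjSwap_mem hy r j, (fpfCovers_conjSwap_iff hy h1
      ((fpfLength_lt_conjSwap_iff hy h1).1 (by omega))).2 h2, j, h1, rfl⟩

theorem mem_psiMinus_iff {y z : Equiv.Perm ℤ} (hy : y ∈ FZ) {r : ℤ} :
    z ∈ psiMinus y r ↔
      ∃ i, i < r ∧ z = conjSwap i r y ∧ fpfLength z = fpfLength y + 1 := by
  constructor
  · rintro ⟨-, h2, j, h3, rfl⟩
    exact ⟨j, h3, rfl, (fpfCovers_conjSwap_iff hy h3 (lt_apply_of_fpfCovers hy h3 h2)).1 h2⟩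
  · rintro ⟨j, h1, rfl, h2⟩
    exact ⟨conjSwap_mem hy j r, (fpfCovers_conjSwap_iff hy h1
      ((fpfLength_lt_conjSwap_iff hy h1).1 (by omega))).2 h2, j, h1, rfl⟩

theorem finite_psiPlus {y : Equiv.Perm ℤ} (hy : y ∈ FZ) (r : ℤ) : (psiPlus y r).Finite := by
  obtain ⟨M, hM, h⟩ := exists_bound_of_mem_FZ hy
  -- Near and beyond k, y is Θ and moves points by at most 1. For j > k + 2 the point k then lies
  -- between r and j in position and in value, forcing a length increase of at least 3.
  set k := max (2 * M) (max r (y r)) + 2 with hk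
  have hk1 : 2 * M + 2 ≤ k := by omega
  have hk2 : r + 2 ≤ k := by omega
  have hk3 : y r + 2 ≤ k := by omega
  refine ((Set.finite_Icc r (k + 2)).image fun j => conjSwap r j y).subset fun z hz => ?_
  obtain ⟨j, h1, rfl, h2⟩ := (mem_psiPlus_iff hy).1 hz
  refine ⟨j, ⟨h1.le, ?_⟩, rfl⟩
  by_contra hj
  have e1 := h k (by omega)
  have e2 := h j (by omega)
  have := fpfLength_add_three_le hy (a := r) (b := j) (k := k) (by omega) (by omega)
    (by rcases theta_cases k with ⟨l, h4, h5⟩ | ⟨l, h4, h5⟩ <;> omega)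
    (by rcases theta_cases k with ⟨l, h4, h5⟩ | ⟨l, h4, h5⟩ <;>
      rcases theta_cases j with ⟨m, h6, h7⟩ | ⟨m, h6, h7⟩ <;> omega)
  omega

theorem finite_psiMinus {y : Equiv.Perm ℤ} (hy : y ∈ FZ) (r : ℤ) : (psiMinus y r).Finite := by
  obtain ⟨M, hM, h⟩ := exists_bound_of_mem_FZ hy
  set k := min (-2 * M) (min r (y r)) - 2 with hk
  have hk1 : k ≤ -2 * M - 2 := by omega
  have hk2 : k ≤ r - 2 := by omega
  have hk3 : k ≤ y r - 2 := by omega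
  refine ((Set.finite_Icc (k - 2) r).image fun j => conjSwap j r y).subset fun z hz => ?_
  obtain ⟨j, h1, rfl, h2⟩ := (mem_psiMinus_iff hy).1 hz
  refine ⟨j, ⟨?_, h1.le⟩, rfl⟩
  by_contra hj
  have e1 := h k (by omega)
  have e2 := h j (by omega)
  have := fpfLength_add_three_le hy (a := j) (b := r) (k := k) (by omega) (by omega)
    (by rcases theta_cases k with ⟨l, h4, h5⟩ | ⟨l, h4, h5⟩ <;>
      rcases theta_cases j with ⟨m, h6, h7⟩ | ⟨m, h6, h7⟩ <;> omega)
    (by rcases theta_cases k with ⟨l, h4, h5⟩ | ⟨l, h4, h5⟩ <;> omega)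
  omega

/-! ### Atoms -/

theorem fpfLength_theta : fpfLength theta = 0 := by
  have : inversions theta \ cycZ theta = ∅ := by
    ext ⟨a, b⟩
    simp only [inversions, cycZ, Set.mem_sdiff, Set.mem_ofPred_eq, Set.mem_empty_iff_false,
      iff_false]
    rintro ⟨⟨h1, h2⟩, h3⟩
    refine h3 ⟨h1.le, ?_⟩
    rcases theta_cases a with ⟨k, h4, h5⟩ | ⟨k, h4, h5⟩ <;>
      rcases theta_cases b with ⟨l, h6, h7⟩ | ⟨l, h6, h7⟩ <;> omega
  simp [fpfLength, this]

theorem conj_theta_mem_FZ {w : Equiv.Perm ℤ} (hw : w ∈ SZ) : w⁻¹ * theta * w ∈ FZ :=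
  ⟨w, hw, rfl⟩

theorem conj_theta_mul_simple (w : Equiv.Perm ℤ) (i : ℤ) :
    (w * simple i)⁻¹ * theta * (w * simple i) = conjSwap i (i + 1) (w⁻¹ * theta * w) := by
  simp only [mul_inv_rev, conjSwap, simple, Equiv.swap_inv, mul_assoc]

/-- Each letter of a reduced word of w changes the FPF length by at most one, starting from 0 at Θ.
-/
theorem fpfLength_conj_theta_le {w : Equiv.Perm ℤ} (hw : w ∈ SZ) :
    fpfLength (w⁻¹ * theta * w) ≤ length w := by
  induction hn : length w using Nat.strong_induction_on generalizing w with
  | _ n ih =>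
    by_cases h1 : w = 1
    · subst h1
      simp [fpfLength_theta]
    · obtain ⟨i, hi⟩ := exists_descent_of_mem_SZ hw h1
      have h2 := length_eq_length_mul_simple_add_one hw hi
      have h3 := ih _ (by omega) (SZ.mul_mem hw (simple_mem_SZ i)) rfl
      rw [conj_theta_mul_simple] at h3
      have := (fpfLength_conjSwap_simple_le (conj_theta_mem_FZ hw) i).2
      omega

/-- Every element of `𝓕_ℤ` other than `Θ` has a descent which is not a cycle. -/
theorem exists_descent_of_mem_FZ {z : Equiv.Perm ℤ} (hz : z ∈ FZ) (hne : z ≠ theta) :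
    ∃ i, z (i + 1) < z i ∧ z i ≠ i + 1 := by
  by_contra hcon
  push Not at hcon
  obtain ⟨M, hM, h⟩ := exists_bound_of_mem_FZ hz
  have hz2 := apply_apply_of_mem_FZ hz
  -- Agreement with Θ spreads from the left, one cycle at a time.
  have key : ∀ m : ℕ, ∀ x, x ≤ -2 * M + 2 * m → z x = theta x := fun m => by
    induction m with
    | zero => exact fun x hx => h x (Or.inl (by simpa using hx))
    | succ m ih =>
      set u := -2 * M + 2 * (m : ℤ) with hu
      have hgt : ∀ x, u < x → u < z x := fun x hx => by
        by_contra h1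
        have h2 := ih (z x) (by omega)
        rw [hz2] at h2
        rcases theta_cases (z x) with ⟨k, h3, h4⟩ | ⟨k, h3, h4⟩ <;> omega
      have h1 : z (u + 1) = u + 2 := by
        by_contra h1
        have h2 := hgt (u + 1) (by omega)
        have h3 := apply_ne_of_mem_FZ hz (u + 1)
        have hb : z (z (u + 1)) = u + 1 := hz2 _
        -- If z(u+1) were not u+2, the absence of non-cycle descents would keep z at or above z(u+1)
        -- up to the position z(u+1), where its value is only u+1.
        have hge : ∀ k, u + 1 ≤ k → k ≤ z (u + 1) → z (u + 1) ≤ z k := fun k hk => by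
          induction k, hk using Int.leInduction with
          | base => exact fun _ => le_rfl
          | succ n hn ih' =>
            intro hn'
            have h4 := ih' (by omega)
            have h5 := hcon n
            have h6 := apply_ne_apply_succ z n
            by_cases h7 : z n = n + 1
            · have h8 : n + 1 = z (u + 1) := by omega
              have h9 : n = u + 1 := by rw [← hb, ← h8, ← h7, hz2]
              omega
            · have : ¬ z (n + 1) < z n := fun h => h7 (h5 h)
              omega
        have := hge (z (u + 1)) (by omega) le_rfl
        omega
      have h2 : z (u + 2) = u + 1 := by rw [← h1, hz2]
      intro x hx
      by_cases hx' : x ≤ u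
      · exact ih x hx'
      · push_cast at hx
        have hxx : x = u + 1 ∨ x = u + 2 := by omega
        rcases hxx with rfl | rfl
        · rcases theta_cases (u + 1) with ⟨k, h3, h4⟩ | ⟨k, h3, h4⟩ <;> omega
        · rcases theta_cases (u + 2) with ⟨k, h3, h4⟩ | ⟨k, h3, h4⟩ <;> omega
  apply hne
  ext x
  exact key (x + 2 * M).toNat x (by omega)

theorem one_le_of_descent {z : Equiv.Perm ℤ} (hz : z ∈ FZ) (h : ∀ x ≤ 0, z x = theta x) {i : ℤ}
    (h1 : z (i + 1) < z i) (h2 : z i ≠ i + 1) : 1 ≤ i := by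
  by_contra hi
  have h3 := h i (by omega)
  rcases eq_or_lt_of_le (show i ≤ 0 by omega) with rfl | hi'
  · have h4 := h (z (0 + 1))
    rw [apply_apply_of_mem_FZ hz] at h4
    rcases theta_cases 0 with ⟨k, h5, h6⟩ | ⟨k, h5, h6⟩ <;>
    rcases theta_cases (z (0 + 1)) with ⟨l, h7, h8⟩ | ⟨l, h7, h8⟩ <;> omega
  · have h4 := h (i + 1) (by omega)
    rcases theta_cases i with ⟨k, h5, h6⟩ | ⟨k, h5, h6⟩ <;>
    rcases theta_cases (i + 1) with ⟨l, h7, h8⟩ | ⟨l, h7, h8⟩ <;> omega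

theorem conjSwap_apply_nonpos {z : Equiv.Perm ℤ} (h : ∀ x ≤ 0, z x = theta x) {i : ℤ}
    (hi : 1 ≤ i) : ∀ x ≤ 0, conjSwap i (i + 1) z x = theta x := fun x hx => by
  rw [conjSwap_simple_apply, simple_apply_of_ne (x := x) (by omega) (by omega), h x hx]
  rcases theta_cases x with ⟨k, h1, h2⟩ | ⟨k, h1, h2⟩ <;>
    exact simple_apply_of_ne (by omega) (by omega)

/-- Removing non-cycle descents one at a time leads to Θ, and the letters used form w. If z agrees
with Θ on the nonpositive integers, all these descents are at positive positions. -/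
theorem exists_conj_theta {z : Equiv.Perm ℤ} (hz : z ∈ FZ) :
    ∃ w ∈ SZ, z = w⁻¹ * theta * w ∧ length w ≤ fpfLength z ∧
      ((∀ x ≤ 0, z x = theta x) → w ∈ SInf) := by
  induction hn : fpfLength z using Nat.strong_induction_on generalizing z with
  | _ n ih =>
    by_cases h1 : z = theta
    · exact ⟨1, SZ.one_mem, by simp [h1], by simp [length_one], fun _ => SInf.one_mem⟩
    · obtain ⟨i, h2, h3⟩ := exists_descent_of_mem_FZ hz h1
      have h4 := fpfLength_conjSwap_of_descent hz h2 h3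
      obtain ⟨w, hw, h5, h6, h7⟩ := ih _ (by omega) (conjSwap_mem hz i (i + 1)) rfl
      refine ⟨w * simple i, SZ.mul_mem hw (simple_mem_SZ i), ?_, ?_, fun h => ?_⟩
      · rw [conj_theta_mul_simple, ← h5, conjSwap_conjSwap]
      · rcases lt_or_gt_of_ne (apply_ne_apply_succ w i) with h8 | h8
        · rw [length_mul_simple_of_lt hw h8]
          omega
        · have := length_eq_length_mul_simple_add_one hw h8
          omega
      · have hi := one_le_of_descent hz h h2 h3
        exact SInf.mul_mem (h7 (conjSwap_apply_nonpos h hi)) (simple_mem hi)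

theorem mem_FInf_iff {z : Equiv.Perm ℤ} : z ∈ FInf ↔ z ∈ FZ ∧ ∀ x ≤ 0, z x = theta x := by
  constructor
  · rintro ⟨w, hw, rfl⟩
    refine ⟨conj_theta_mem_FZ hw.1, fun x hx => ?_⟩
    have hfix : ∀ x ≤ 0, w x = x := fun x hx => by
      by_contra h
      have := hw.2 x h
      omega
    rw [Equiv.Perm.mul_apply, Equiv.Perm.mul_apply, hfix x hx, Equiv.Perm.inv_eq_iff_eq, hfix]
    rcases theta_cases x with ⟨k, h1, h2⟩ | ⟨k, h1, h2⟩ <;> omega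
  · rintro ⟨h1, h2⟩
    obtain ⟨w, -, h3, -, h4⟩ := exists_conj_theta h1
    exact ⟨w, h4 h2, h3⟩

theorem conjSwap_mem_FInf_iff {z : Equiv.Perm ℤ} {i : ℤ} (hi : 1 ≤ i) :
    conjSwap i (i + 1) z ∈ FInf ↔ z ∈ FInf := by
  have key : ∀ z ∈ FInf, conjSwap i (i + 1) z ∈ FInf := fun z hz => by
    rw [mem_FInf_iff] at hz ⊢
    exact ⟨conjSwap_mem hz.1 _ _, conjSwap_apply_nonpos hz.2 hi⟩
  refine ⟨fun h => ?_, key z⟩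
  have := key _ h
  rwa [conjSwap_conjSwap] at this

/-- `fpfLength_conj_theta_le` bounds the length below and `exists_conj_theta` attains the bound, so
minimality is an equation. -/
theorem mem_fpfAtoms_iff {z w : Equiv.Perm ℤ} (hz : z ∈ FZ) :
    w ∈ fpfAtoms z ↔ w ∈ SZ ∧ z = w⁻¹ * theta * w ∧ length w = fpfLength z := by
  constructor
  · rintro ⟨h1, h2, h3⟩
    obtain ⟨v, hv, h4, h5, -⟩ := exists_conj_theta hz
    have h6 := h3 v hv h4
    have h7 := fpfLength_conj_theta_le h1
    rw [← h2] at h7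
    exact ⟨h1, h2, by omega⟩
  · rintro ⟨h1, h2, h3⟩
    refine ⟨h1, h2, fun v hv h4 => ?_⟩
    have h7 := fpfLength_conj_theta_le hv
    rw [← h4] at h7
    omega

/-- A descent of an atom is a descent of the involution, and gives a shorter atom. -/
theorem mul_simple_mem_fpfAtoms {z w : Equiv.Perm ℤ} (hz : z ∈ FZ) (hw : w ∈ fpfAtoms z) {i : ℤ}
    (hi : w (i + 1) < w i) : (z (i + 1) < z i ∧ z i ≠ i + 1) ∧
      w * simple i ∈ fpfAtoms (conjSwap i (i + 1) z) := by
  rw [mem_fpfAtoms_iff hz] at hw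
  obtain ⟨h1, h2, h3⟩ := hw
  rw [mem_fpfAtoms_iff (conjSwap_mem hz _ _)]
  have h4 := SZ.mul_mem h1 (simple_mem_SZ i)
  have h5 := fpfLength_conj_theta_le h4
  have h6 := length_eq_length_mul_simple_add_one h1 hi
  rw [conj_theta_mul_simple, ← h2] at h5
  have h7 := fpfLength_conjSwap_simple_le hz i
  refine ⟨?_, h4, by rw [conj_theta_mul_simple, ← h2], by omega⟩
  rcases simple_trichotomy z i with h | h | h
  · have := fpfLength_conjSwap_of_ascent hz h
    omega
  · exact h
  · rw [conjSwap_eq_self hz h] at h5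
    omega

theorem mul_simple_mem_fpfAtoms_of_descent {z w : Equiv.Perm ℤ} (hz : z ∈ FZ) {i : ℤ}
    (hi : z (i + 1) < z i) (hi' : z i ≠ i + 1) (hw : w ∈ fpfAtoms (conjSwap i (i + 1) z)) :
    w * simple i ∈ fpfAtoms z ∧ w i < w (i + 1) := by
  rw [mem_fpfAtoms_iff (conjSwap_mem hz _ _)] at hw
  obtain ⟨h1, h2, h3⟩ := hw
  rw [mem_fpfAtoms_iff hz]
  have h4 := SZ.mul_mem h1 (simple_mem_SZ i)
  have h5 := fpfLength_conj_theta_le h4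
  have h6 := fpfLength_conjSwap_of_descent hz hi hi'
  have h7 : z = (w * simple i)⁻¹ * theta * (w * simple i) := by
    rw [conj_theta_mul_simple, ← h2, conjSwap_conjSwap]
  rw [← h7] at h5
  rcases lt_or_gt_of_ne (apply_ne_apply_succ w i) with h8 | h8
  · rw [length_mul_simple_of_lt h1 h8] at h5 ⊢
    exact ⟨⟨h4, h7, by omega⟩, h8⟩
  · have := length_eq_length_mul_simple_add_one h1 h8
    omega

theorem fpfAtoms_subset_SInf {z w : Equiv.Perm ℤ} (hz : z ∈ FInf) (hw : w ∈ fpfAtoms z) :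
    w ∈ SInf := by
  induction hn : length w using Nat.strong_induction_on generalizing z w with
  | _ n ih =>
    by_cases h1 : w = 1
    · rw [h1]
      exact SInf.one_mem
    · obtain ⟨i, hi⟩ := exists_descent_of_mem_SZ hw.1 h1
      have hz' := mem_FInf_iff.1 hz
      obtain ⟨h2, h3⟩ := mul_simple_mem_fpfAtoms hz'.1 hw hi
      have h4 := one_le_of_descent hz'.1 hz'.2 h2.1 h2.2
      have h5 := length_eq_length_mul_simple_add_one hw.1 hi
      have := SInf.mul_mem (ih _ (by omega) ((conjSwap_mem_FInf_iff h4).2 hz) h3 rfl)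
        (simple_mem h4)
      rwa [mul_simple_mul_simple] at this

/-- An atom other than 1 ends in some s_i with i a non-cycle descent of z. There are finitely many
such i, and removing s_i leaves an atom of a shorter involution. -/
theorem finite_fpfAtoms {z : Equiv.Perm ℤ} (hz : z ∈ FZ) : (fpfAtoms z).Finite := by
  induction hn : fpfLength z using Nat.strong_induction_on generalizing z with
  | _ n ih =>
    have hD : {i | z (i + 1) < z i ∧ z i ≠ i + 1}.Finite := by
      have := (finite_inversions_diff_cycZ hz).preimage (f := fun i : ℤ => (i, i + 1))
        (fun i _ j _ h => (Prod.mk.inj h).1)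
      refine this.subset fun i hi => ⟨⟨by simp, hi.1⟩, fun h => hi.2 h.2.symm⟩
    refine ((Set.finite_singleton (1 : Equiv.Perm ℤ)).union (hD.biUnion fun i hi =>
      (ih (fpfLength (conjSwap i (i + 1) z)) ?_ (conjSwap_mem hz i (i + 1)) rfl).image
        (· * simple i))).subset fun w hw => ?_
    · have := fpfLength_conjSwap_of_descent hz hi.1 hi.2
      omega
    · by_cases h1 : w = 1
      · exact Or.inl h1
      · obtain ⟨i, hi⟩ := exists_descent_of_mem_SZ hw.1 h1
        obtain ⟨h2, h3⟩ := mul_simple_mem_fpfAtoms hz hw hi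
        exact Or.inr (Set.mem_biUnion h2 ⟨_, h3, mul_simple_mul_simple _ _⟩)

theorem constantCoeff_fpfSchubert {z : Equiv.Perm ℤ} (hz : fpfLength z ≠ 0) :
    MvPolynomial.constantCoeff (fpfSchubert z) = 0 := by
  unfold fpfSchubert
  split_ifs with h
  · have hz' := (mem_FInf_iff.1 h).1
    have := AddMonoidHom.map_finsum_mem schubert
      (MvPolynomial.constantCoeff (σ := ℕ+) (R := ℤ)).toAddMonoidHom (finite_fpfAtoms hz')
    refine this.trans (finsum_mem_of_eqOn_zero fun w hw => constantCoeff_schubert ?_)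
    rwa [((mem_fpfAtoms_iff hz').1 hw).2.2]
  · exact map_zero _

-- Atoms ascending at i are killed by ∂_i. Those descending at i exist only if i is a non-cycle
-- descent of z, and w ↦ w s_i then maps them bijectively onto the atoms of s_i z s_i.
open Classical in
theorem dividedDiff_fpfSchubert {z : Equiv.Perm ℤ} (hz : z ∈ FZ) (i : ℕ+) :
    dividedDiff i (fpfSchubert z) =
      if z (i + 1) < z i ∧ z i ≠ i + 1 then fpfSchubert (conjSwap i (i + 1) z) else 0 := by
  have hi : (1 : ℤ) ≤ i := by exact_mod_cast i.pos
  by_cases hF : z ∈ FInf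
  · have h1 : dividedDiff i (fpfSchubert z) =
        ∑ᶠ w ∈ fpfAtoms z, dividedDiff i (schubert w) := by
      rw [fpfSchubert, if_pos hF]
      exact AddMonoidHom.map_finsum_mem schubert (dividedDiffHom i) (finite_fpfAtoms hz)
    rw [h1]
    split_ifs with h
    · have h2 : ∑ᶠ w ∈ fpfAtoms z, dividedDiff i (schubert w) =
          ∑ᶠ w ∈ {w | w ∈ fpfAtoms z ∧ w (i + 1) < w i}, dividedDiff i (schubert w) := by
        refine finsum_mem_inter_support_eq' _ _ _ fun w hw => ⟨fun h3 => ⟨h3, ?_⟩, fun h3 => h3.1⟩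
        by_contra h4
        have := apply_ne_apply_succ w i
        exact hw (dividedDiff_schubert_of_ascent (fpfAtoms_subset_SInf hF h3) (by omega))
      have h3 : fpfAtoms (conjSwap i (i + 1) z) =
          (· * simple i) '' {w | w ∈ fpfAtoms z ∧ w (i + 1) < w i} := by
        ext w
        constructor
        · intro hw
          obtain ⟨h4, h5⟩ := mul_simple_mem_fpfAtoms_of_descent hz h.1 h.2 hw
          refine ⟨w * simple i, ⟨h4, ?_⟩, mul_simple_mul_simple _ _⟩
          simpa [Equiv.Perm.mul_apply, simple_apply_left, simple_apply_right] using h5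
        · rintro ⟨w, ⟨h4, h5⟩, rfl⟩
          exact (mul_simple_mem_fpfAtoms hz h4 h5).2
      rw [h2, fpfSchubert, if_pos ((conjSwap_mem_FInf_iff hi).2 hF), h3,
        finsum_mem_image (mul_left_injective _).injOn]
      exact finsum_mem_congr rfl fun w hw =>
        dividedDiff_schubert_of_descent (fpfAtoms_subset_SInf hF hw.1) hw.2
    · refine finsum_mem_of_eqOn_zero fun w hw => ?_
      have h4 : ¬ w (i + 1) < w i := fun h4 => h (mul_simple_mem_fpfAtoms hz hw h4).1
      have := apply_ne_apply_succ w i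
      exact dividedDiff_schubert_of_ascent (fpfAtoms_subset_SInf hF hw) (by omega)
  -- Since i ≥ 1, conjugation by s_i neither enters nor leaves 𝓕_∞, so the zero convention is
  -- respected.
  · have hF' : conjSwap i (i + 1) z ∉ FInf := fun h => hF ((conjSwap_mem_FInf_iff hi).1 h)
    rw [fpfSchubert, if_neg hF, dividedDiff_zero, fpfSchubert, if_neg hF', ite_self]

/-! ### Covers and conjugation by simple transpositions -/

/-- The sets `Ψ⁺(y, r)` (for `ε = 1`) and `Ψ⁻(y, r)` (for `ε = -1`), described by length. -/
def psiSigned (ε : ℤ) (y : Equiv.Perm ℤ) (r : ℤ) : Set (Equiv.Perm ℤ) :=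
  {z | ∃ j, 0 < ε * (j - r) ∧ z = conjSwap r j y ∧ fpfLength z = fpfLength y + 1}

theorem psiPlus_eq {y : Equiv.Perm ℤ} (hy : y ∈ FZ) (r : ℤ) :
    psiPlus y r = psiSigned 1 y r := by
  ext z
  simp [mem_psiPlus_iff hy, psiSigned]

theorem psiMinus_eq {y : Equiv.Perm ℤ} (hy : y ∈ FZ) (r : ℤ) :
    psiMinus y r = psiSigned (-1) y r := by
  ext z
  simp only [mem_psiMinus_iff hy, psiSigned, Set.mem_ofPred_eq]
  refine exists_congr fun j => ?_
  rw [conjSwap_comm j r]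
  exact and_congr_left' (by omega)

theorem psiSigned_subset_FZ {ε : ℤ} {y : Equiv.Perm ℤ} (hy : y ∈ FZ) (r : ℤ) :
    psiSigned ε y r ⊆ FZ := by
  rintro z ⟨j, -, rfl, -⟩
  exact conjSwap_mem hy r j

theorem fpfLength_lt_conjSwap_iff_signed {ε : ℤ} (hε : ε = 1 ∨ ε = -1) {y : Equiv.Perm ℤ}
    (hy : y ∈ FZ) {a b : ℤ} (hab : 0 < ε * (b - a)) :
    fpfLength y < fpfLength (conjSwap a b y) ↔ 0 < ε * (y b - y a) := by
  rcases hε with rfl | rfl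
  · rw [fpfLength_lt_conjSwap_iff hy (by omega)]
    omega
  · rw [conjSwap_comm, fpfLength_lt_conjSwap_iff hy (by omega)]
    omega

/-- The elements ascending at `i` whose conjugates by `s_i` lie in `S`. -/
def ascentConj (i : ℤ) (S : Set (Equiv.Perm ℤ)) : Set (Equiv.Perm ℤ) :=
  {z | z i < z (i + 1) ∧ conjSwap i (i + 1) z ∈ S}

/-- Only the pair {i, i+1} has its order reversed by s_i. The equation on a encodes, for both signs,
which endpoint a is: i for ε = 1 and i+1 for ε = -1. -/
theorem simple_sub_pos {ε : ℤ} (hε : ε = 1 ∨ ε = -1) {i a b : ℤ} (h : 0 < ε * (b - a)) :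
    0 < ε * (simple i b - simple i a) ∨
      ((a = i ∧ b = i + 1 ∨ a = i + 1 ∧ b = i) ∧ 2 * a = 2 * i + 1 - ε) := by
  rcases hε with rfl | rfl <;> rcases simple_cases i a with h1 | h1 | h1 <;>
    rcases simple_cases i b with h2 | h2 | h2 <;> omega

theorem conjSwap_eq_simple {i a b : ℤ} (h : a = i ∧ b = i + 1 ∨ a = i + 1 ∧ b = i)
    (y : Equiv.Perm ℤ) : conjSwap a b y = conjSwap i (i + 1) y := by
  rcases h with ⟨rfl, rfl⟩ | ⟨rfl, rfl⟩
  · rfl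
  · rw [conjSwap_comm]

theorem conjSwap_injective (a b : ℤ) : Function.Injective (conjSwap a b) :=
  Function.LeftInverse.injective (conjSwap_conjSwap a b)

theorem conjSwap_conjSwap_simple (i a b : ℤ) (y : Equiv.Perm ℤ) :
    conjSwap i (i + 1) (conjSwap a b y) =
      conjSwap (simple i a) (simple i b) (conjSwap i (i + 1) y) := by
  rw [← conjSwap_simple_conj, conjSwap_conjSwap]

/-- The conjugate by `s_i` arises from the pair `(r, j)` for a suitable `j`. -/
theorem exists_conjSwap_eq_simple {ε : ℤ} (hε : ε = 1 ∨ ε = -1) {y : Equiv.Perm ℤ} (hy : y ∈ FZ)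
    {i r : ℤ} (h : 2 * r = 2 * i + 1 - ε ∨ 2 * y r = 2 * i + 1 - ε) (hi : y i < y (i + 1)) :
    ∃ j, 0 < ε * (j - r) ∧ conjSwap r j y = conjSwap i (i + 1) y := by
  have hy2 := apply_apply_of_mem_FZ hy
  rcases h with h | h
  · refine ⟨simple i r, ?_, conjSwap_eq_simple ?_ y⟩ <;>
    rcases hε with rfl | rfl <;> rcases simple_cases i r with h1 | h1 | h1 <;> omega
  · have e : r = y (y r) := (hy2 r).symm
    have hne : y r ≠ simple i (y r) := by
      rcases hε with rfl | rfl <;> rcases simple_cases i (y r) with h1 | h1 | h1 <;> omega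
    refine ⟨y (simple i (y r)), ?_, ?_⟩
    · rw [e, hy2]
      rcases hε with rfl | rfl <;> rcases simple_cases i (y r) with h1 | h1 | h1
      · rw [h1.2, h1.1]; omega
      · omega
      · omega
      · omega
      · rw [h1.2, h1.1]; omega
      · omega
    · rw [conjSwap_eq_conjSwap_apply hy, hy2]
      · apply conjSwap_eq_simple
        rcases hε with rfl | rfl <;> rcases simple_cases i (y r) with h1 | h1 | h1 <;> omega
      · intro h1
        have := congrArg y h1
        rw [hy2] at this
        exact hne this

/-- Such a z has the same length as y and is a transposition conjugate of s_i y s_i. If s_i kept the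
order of both the positions r, j and the values y r, y j, then z would be longer than s_i y s_i,
hence longer than y. So one of these pairs is {i, i+1}, the cover is s_i y s_i, and z = y. -/
theorem eq_of_mem_ascentConj_psiSigned {ε : ℤ} (hε : ε = 1 ∨ ε = -1) {y z : Equiv.Perm ℤ}
    (hy : y ∈ FZ) {i r : ℤ} (hi : fpfLength y ≤ fpfLength (conjSwap i (i + 1) y))
    (hz : z ∈ ascentConj i (psiSigned ε y r)) :
    z = y ∧ (2 * r = 2 * i + 1 - ε ∨ 2 * y r = 2 * i + 1 - ε) ∧
      fpfLength (conjSwap i (i + 1) y) = fpfLength y + 1 := by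
  obtain ⟨h1, j, h2, h3, h4⟩ := hz
  have mz : z ∈ FZ := by
    rw [← conjSwap_conjSwap i (i + 1) z, h3]
    exact conjSwap_mem (conjSwap_mem hy _ _) _ _
  have h5 := fpfLength_conjSwap_of_ascent mz h1
  have my := conjSwap_mem hy i (i + 1)
  have e : z = conjSwap (simple i r) (simple i j) (conjSwap i (i + 1) y) := by
    rw [← conjSwap_conjSwap_simple, ← h3, conjSwap_conjSwap]
  have h6 : 0 < ε * (y j - y r) := by
    rw [← fpfLength_lt_conjSwap_iff_signed hε hy h2, ← h3]
    omega
  rw [h3] at h4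
  have hrj : r ≠ j := by
    rintro rfl
    simp at h2
  rcases simple_sub_pos hε (i := i) h2 with h7 | h7
  · rcases simple_sub_pos hε (i := i) h6 with h8 | h8
    · have := (fpfLength_lt_conjSwap_iff_signed hε my h7).2 (by
        rw [conjSwap_simple_apply, conjSwap_simple_apply, simple_simple, simple_simple]
        exact h8)
      rw [← e] at this
      rw [h3] at h5
      omega
    · have h9 : conjSwap r j y = conjSwap i (i + 1) y := by
        rw [conjSwap_eq_conjSwap_apply hy hrj, conjSwap_eq_simple h8.1]
      rw [h9] at h3 h4
      exact ⟨conjSwap_injective _ _ h3, Or.inr h8.2, h4⟩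
  · have h9 := conjSwap_eq_simple h7.1 y
    rw [h9] at h3 h4
    exact ⟨conjSwap_injective _ _ h3, Or.inl h7.2, h4⟩

theorem ascentConj_psiSigned_of_fixed {ε : ℤ} (hε : ε = 1 ∨ ε = -1) {y : Equiv.Perm ℤ}
    (hy : y ∈ FZ) {i : ℤ} (r : ℤ) (hi : y i = i + 1) : ascentConj i (psiSigned ε y r) = ∅ := by
  refine Set.eq_empty_of_forall_notMem fun z hz => ?_
  have := eq_of_mem_ascentConj_psiSigned hε hy (by rw [conjSwap_eq_self hy hi]) hz
  rw [conjSwap_eq_self hy hi] at this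
  omega

theorem ascentConj_psiSigned_of_ascent {ε : ℤ} (hε : ε = 1 ∨ ε = -1) {y : Equiv.Perm ℤ}
    (hy : y ∈ FZ) {i : ℤ} (r : ℤ) (hi : y i < y (i + 1)) :
    ascentConj i (psiSigned ε y r) =
      {z | z = y ∧ (2 * r = 2 * i + 1 - ε ∨ 2 * y r = 2 * i + 1 - ε)} := by
  have hl := fpfLength_conjSwap_of_ascent hy hi
  ext z
  constructor
  · intro hz
    have := eq_of_mem_ascentConj_psiSigned hε hy (by omega) hz
    exact ⟨this.1, this.2.1⟩
  · rintro ⟨rfl, h⟩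
    obtain ⟨j, h1, h2⟩ := exists_conjSwap_eq_simple hε hy h hi
    exact ⟨hi, j, h1, h2.symm, hl⟩

/-- Conjugation by s_i moves (r, j) to (s_i r, s_i j) and matches covers of s_i y s_i with covers of
y, unless s_i reverses the order of the positions or of the values. In that case the transposition
acts as s_i itself, and the cover of s_i y s_i is y. -/
theorem psiSigned_conjSwap_of_descent {ε : ℤ} (hε : ε = 1 ∨ ε = -1) {y : Equiv.Perm ℤ}
    (hy : y ∈ FZ) {i : ℤ} (r : ℤ) (hi : y (i + 1) < y i) (hi' : y i ≠ i + 1) :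
    psiSigned ε (conjSwap i (i + 1) y) (simple i r) =
      ascentConj i (psiSigned ε y r) ∪
        {z | z = y ∧ (2 * r = 2 * i + 1 + ε ∨ 2 * y r = 2 * i + 1 + ε)} := by
  have hl := fpfLength_conjSwap_of_descent hy hi hi'
  have my := conjSwap_mem hy i (i + 1)
  have hy2 := apply_apply_of_mem_FZ hy
  have hne := apply_ne_of_mem_FZ hy
  ext z
  constructor
  · rintro ⟨j, h1, h2, h3⟩
    have mz : z ∈ FZ := h2 ▸ conjSwap_mem my _ _
    have e : conjSwap i (i + 1) z = conjSwap r (simple i j) y := by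
      rw [h2, conjSwap_simple_conj, simple_simple]
    have h4 := (fpfLength_lt_conjSwap_iff_signed hε my h1).1 (by rw [← h2]; omega)
    have h1' := simple_sub_pos hε (i := i) h1
    have h4' := simple_sub_pos hε (i := i) h4
    rw [conjSwap_simple_apply, conjSwap_simple_apply] at h4'
    simp only [simple_simple] at h1' h4'
    have hrj : r ≠ simple i j := by
      rintro h
      rw [h, simple_simple] at h1
      simp at h1
    rcases h1' with h5 | h5
    · rcases h4' with h6 | h6
      · left
        have h7 := (fpfLength_lt_conjSwap_iff_signed hε hy h5).2 h6
        rw [← e] at h7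
        have h8 := fpfLength_conjSwap_simple_le mz i
        refine ⟨?_, simple i j, h5, e, by omega⟩
        rcases simple_trichotomy z i with h | h | h
        · exact h
        · have := fpfLength_conjSwap_of_descent mz h.1 h.2
          omega
        · rw [conjSwap_eq_self mz h] at h7
          omega
      · right
        have h9 : conjSwap r (simple i j) y = conjSwap i (i + 1) y := by
          rw [conjSwap_eq_conjSwap_apply hy hrj, conjSwap_eq_simple]
          rcases simple_cases i (y r) with h7 | h7 | h7 <;>
            rcases simple_cases i (y (simple i j)) with h8 | h8 | h8 <;> omega
        refine ⟨conjSwap_injective _ _ (e.trans h9), Or.inr ?_⟩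
        rcases hε with rfl | rfl <;> rcases simple_cases i (y r) with h7 | h7 | h7 <;> omega
    · right
      have h9 : conjSwap r (simple i j) y = conjSwap i (i + 1) y := by
        rw [conjSwap_eq_simple]
        rcases simple_cases i r with h7 | h7 | h7 <;>
          rcases simple_cases i j with h8 | h8 | h8 <;> omega
      refine ⟨conjSwap_injective _ _ (e.trans h9), Or.inl ?_⟩
      rcases hε with rfl | rfl <;> rcases simple_cases i r with h7 | h7 | h7 <;> omega
  · rintro (⟨h1, j, h2, h3, h4⟩ | ⟨rfl, h⟩)
    · have mz : z ∈ FZ := by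
        rw [← conjSwap_conjSwap i (i + 1) z, h3]
        exact conjSwap_mem (conjSwap_mem hy _ _) _ _
      have h5 := fpfLength_conjSwap_of_ascent mz h1
      have e : z = conjSwap (simple i r) (simple i j) (conjSwap i (i + 1) y) := by
        rw [← conjSwap_conjSwap_simple, ← h3, conjSwap_conjSwap]
      refine ⟨simple i j, ?_, e, by omega⟩
      rcases simple_sub_pos hε (i := i) h2 with h6 | h6
      · exact h6
      · rw [h3, conjSwap_eq_simple h6.1] at h4
        omega
    · have n1 : z (i + 1) ≠ i := fun h'' => hi' (by have := hy2 (i + 1); rwa [h''] at this)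
      have n2 := hne i
      have n3 := hne (i + 1)
      have hr : z (simple i (simple i r)) = z r := by rw [simple_simple]
      obtain ⟨j, h1, h2⟩ := exists_conjSwap_eq_simple (r := simple i r) (i := i) hε my (by
        rw [conjSwap_simple_apply, hr]
        rcases hε with rfl | rfl <;> rcases simple_cases i r with h1 | h1 | h1 <;>
          rcases simple_cases i (z r) with h2 | h2 | h2 <;> omega) (by
        rw [conjSwap_simple_apply, conjSwap_simple_apply, simple_apply_left, simple_apply_right,
          simple_apply_of_ne n1 n3, simple_apply_of_ne n2 hi']
        exact hi)
      rw [conjSwap_conjSwap] at h2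
      exact ⟨j, h1, h2.symm, hl⟩

/-! ### The transition formula -/

/-- Terms without a non-cycle descent at i vanish, and conjugation by s_i maps the others
bijectively onto the new index set. -/
theorem dividedDiff_finsum_fpfSchubert {S : Set (Equiv.Perm ℤ)} (hS : S.Finite) (hF : S ⊆ FZ)
    (i : ℕ+) : dividedDiff i (∑ᶠ z ∈ S, fpfSchubert z) = ∑ᶠ z ∈ ascentConj i S, fpfSchubert z := by
  classical
  have h1 : dividedDiff i (∑ᶠ z ∈ S, fpfSchubert z) =
      ∑ᶠ z ∈ S, dividedDiff i (fpfSchubert z) :=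
    AddMonoidHom.map_finsum_mem fpfSchubert (dividedDiffHom i) hS
  have h2 : ∑ᶠ z ∈ S, dividedDiff i (fpfSchubert z) =
      ∑ᶠ z ∈ {z | z ∈ S ∧ z (i + 1) < z i ∧ z i ≠ i + 1}, dividedDiff i (fpfSchubert z) := by
    refine finsum_mem_inter_support_eq' _ _ _ fun z hz => ⟨fun h3 => ⟨h3, ?_⟩, fun h3 => h3.1⟩
    by_contra h4
    exact hz ((dividedDiff_fpfSchubert (hF h3) i).trans (if_neg h4))
  have apply_conj : ∀ z : Equiv.Perm ℤ, z ∈ FZ → z i ≠ i + 1 →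
      conjSwap i (i + 1) z i = z (i + 1) ∧ conjSwap i (i + 1) z (i + 1) = z i := by
    intro z hz h
    have hz2 := apply_apply_of_mem_FZ hz
    have hne := apply_ne_of_mem_FZ hz
    rw [conjSwap_simple_apply, conjSwap_simple_apply, simple_apply_left, simple_apply_right,
      simple_apply_of_ne (hne i) h, simple_apply_of_ne (fun h' => h (by
        have := hz2 (i + 1)
        rwa [h'] at this)) (hne _)]
    exact ⟨rfl, rfl⟩
  have h3 : ascentConj i S =
      conjSwap i (i + 1) '' {z | z ∈ S ∧ z (i + 1) < z i ∧ z i ≠ i + 1} := by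
    ext z
    constructor
    · rintro ⟨h4, h5⟩
      have mz : z ∈ FZ := by
        rw [← conjSwap_conjSwap i (i + 1) z]
        exact conjSwap_mem (hF h5) _ _
      have n : z i ≠ i + 1 := fun h => by
        have := apply_apply_of_mem_FZ mz i
        rw [h] at this
        omega
      obtain ⟨h6, h7⟩ := apply_conj z mz n
      refine ⟨_, ⟨h5, ?_, ?_⟩, conjSwap_conjSwap _ _ _⟩
      · rw [h6, h7]
        exact h4
      · rw [h6]
        exact apply_ne_of_mem_FZ mz _
    · rintro ⟨z, ⟨h4, h5, h6⟩, rfl⟩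
      obtain ⟨h7, h8⟩ := apply_conj z (hF h4) h6
      exact ⟨by rw [h7, h8]; exact h5, by rwa [conjSwap_conjSwap]⟩
  rw [h1, h2, h3, finsum_mem_image (conjSwap_injective _ _).injOn]
  exact finsum_mem_congr rfl fun z hz => by
    rw [dividedDiff_fpfSchubert (hF hz.1), if_pos hz.2]

open Classical in
theorem finsum_mem_singleton_and {f : Equiv.Perm ℤ → Poly} (y : Equiv.Perm ℤ) (P : Prop) :
    ∑ᶠ z ∈ {z | z = y ∧ P}, f z = if P then f y else 0 := by
  split_ifs with h
  · simp [h]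
  · simp [h]

theorem dividedDiff_X (i p : ℕ+) :
    dividedDiff i (X p) = (if p = i then 1 else 0) - (if p = i + 1 then 1 else 0) := by
  have hi : i + 1 ≠ i := (PNat.lt_add_right i 1).ne'
  apply dividedDiff_unique
  by_cases h1 : p = i
  · subst h1
    rw [simpleAct_X_self, if_pos rfl, if_neg hi.symm]
    ring
  · by_cases h2 : p = i + 1
    · subst h2
      rw [simpleAct_X_succ, if_neg h1, if_pos rfl]
      ring
    · rw [simpleAct_X_of_ne h1 h2, if_neg h1, if_neg h2]
      ring

theorem constantCoeff_finsum_psiSigned (ε : ℤ) {y : Equiv.Perm ℤ} (r : ℤ)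
    (hf : (psiSigned ε y r).Finite) :
    constantCoeff (∑ᶠ z ∈ psiSigned ε y r, fpfSchubert z) = 0 := by
  have := AddMonoidHom.map_finsum_mem fpfSchubert
    (constantCoeff (σ := ℕ+) (R := ℤ)).toAddMonoidHom hf
  refine this.trans (finsum_mem_of_eqOn_zero ?_)
  rintro z ⟨j, -, -, h⟩
  exact constantCoeff_fpfSchubert (by omega)

theorem coe_swap_succ (i p : ℕ+) : ((Equiv.swap i (i + 1) p : ℕ+) : ℤ) = simple i p := by
  have hc : ((i + 1 : ℕ+) : ℤ) = i + 1 := by push_cast; rfl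
  by_cases h1 : p = i
  · rw [h1, Equiv.swap_apply_left, simple_apply_left, hc]
  · by_cases h2 : p = i + 1
    · rw [h2, Equiv.swap_apply_right, hc, simple_apply_right]
    · rw [Equiv.swap_apply_of_ne_of_ne h1 h2, simple_apply_of_ne]
      · exact_mod_cast h1
      · rw [← hc]
        exact_mod_cast h2

theorem transition_formula {y : Equiv.Perm ℤ} (hy : y ∈ FInf) {p q : ℕ+} (hpq : p < q)
    (hq : y p = q) :
    (X p + X q) * fpfSchubert y = (∑ᶠ z ∈ psiSigned 1 y q, fpfSchubert z) -
      ∑ᶠ z ∈ psiSigned (-1) y p, fpfSchubert z := by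
  classical
  induction hn : fpfLength y using Nat.strong_induction_on generalizing y p q with
  | _ n ih =>
    have hFZ := (mem_FInf_iff.1 hy).1
    have hp : y q = p := by rw [← hq, apply_apply_of_mem_FZ hFZ]
    have fin1 : (psiSigned 1 y q).Finite := psiPlus_eq hFZ q ▸ finite_psiPlus hFZ q
    have fin2 : (psiSigned (-1) y p).Finite := psiMinus_eq hFZ p ▸ finite_psiMinus hFZ p
    rw [← sub_eq_zero]
    -- No base case is needed: when no ∂_i invokes the induction hypothesis, the argument still
    -- shows that the difference is a constant with zero constant term.
    have h0 := eq_C_of_dividedDiff_eq_zero (f := (X p + X q) * fpfSchubert y -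
      ((∑ᶠ z ∈ psiSigned 1 y q, fpfSchubert z) -
      ∑ᶠ z ∈ psiSigned (-1) y p, fpfSchubert z)) fun i => ?_
    · rw [h0]
      simp [constantCoeff_finsum_psiSigned _ _ fin1, constantCoeff_finsum_psiSigned _ _ fin2]
    have hi : (1 : ℤ) ≤ i := by exact_mod_cast i.pos
    have hpq' : (p : ℤ) < q := by exact_mod_cast hpq
    have cp : p = i ↔ (p : ℤ) = i := by norm_cast
    have cq : q = i ↔ (q : ℤ) = i := by norm_cast
    have cp' : p = i + 1 ↔ (p : ℤ) = i + 1 := by norm_cast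
    have cq' : q = i + 1 ↔ (q : ℤ) = i + 1 := by norm_cast
    rw [dividedDiff_sub, dividedDiff_sub, dividedDiff_mul, dividedDiff_add, dividedDiff_X,
      dividedDiff_X, dividedDiff_finsum_fpfSchubert fin1 (psiSigned_subset_FZ hFZ q),
      dividedDiff_finsum_fpfSchubert fin2 (psiSigned_subset_FZ hFZ p),
      dividedDiff_fpfSchubert hFZ, simpleAct_add, simpleAct_X, simpleAct_X]
    simp only [cp, cq, cp', cq']
    rcases simple_trichotomy y i with h | h | h
    · have hd : ¬ (y (i + 1) < y i ∧ y i ≠ i + 1) := by omega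
      rw [if_neg hd, ascentConj_psiSigned_of_ascent (Or.inl rfl) hFZ _ h,
        ascentConj_psiSigned_of_ascent (Or.inr rfl) hFZ _ h, finsum_mem_singleton_and,
        finsum_mem_singleton_and, hp, hq]
      have n1 : ¬ ((p : ℤ) = i ∧ (q : ℤ) = i + 1) := fun h' => by
        rw [← h'.1, hq, h'.1, ← h'.2, hp] at h
        omega
      -- The coefficient of the surviving term is +1 if p or q is i and -1 if p or q is i+1, as in
      -- ∂_i(x_p + x_q).
      split_ifs <;> first | (exfalso; omega) | ring
    · rw [if_pos h]
      have hl := fpfLength_conjSwap_of_descent hFZ h.1 h.2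
      have n1 : ¬ ((p : ℤ) = i ∧ (q : ℤ) = i + 1) := fun h' => h.2 (by rw [← h'.1, hq, h'.1, h'.2])
      have hrec := ih _ (by omega) ((conjSwap_mem_FInf_iff hi).2 hy)
        (p := Equiv.swap i (i + 1) p) (q := Equiv.swap i (i + 1) q) (by
          have : ((Equiv.swap i (i + 1) p : ℕ+) : ℤ) < (Equiv.swap i (i + 1) q : ℕ+) := by
            rw [coe_swap_succ, coe_swap_succ]
            rcases simple_cases i p with h1 | h1 | h1 <;>
              rcases simple_cases i q with h2 | h2 | h2 <;> omega
          exact_mod_cast this) (by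
          rw [coe_swap_succ, coe_swap_succ, conjSwap_simple_apply, simple_simple, hq]) rfl
      have dis : ∀ (ε r : ℤ) (P : Prop), Disjoint (ascentConj i (psiSigned ε y r))
          {z | z = y ∧ P} := fun ε r P => Set.disjoint_left.2 fun z hz hz' => by
        rw [hz'.1] at hz
        have := hz.1
        omega
      have hfin : ∀ (ε r : ℤ), (psiSigned ε y r).Finite →
          (ascentConj i (psiSigned ε y r)).Finite := fun ε r hf =>
        hf.preimage (conjSwap_injective _ _).injOn |>.subset fun z hz => hz.2
      have hfin' : ∀ P : Prop, {z | z = y ∧ P}.Finite := fun P =>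
        (Set.finite_singleton y).subset fun z hz => hz.1
      rw [coe_swap_succ, coe_swap_succ,
        psiSigned_conjSwap_of_descent (Or.inl rfl) hFZ _ h.1 h.2,
        psiSigned_conjSwap_of_descent (Or.inr rfl) hFZ _ h.1 h.2,
        finsum_mem_union (dis _ _ _) (hfin _ _ fin1) (hfin' _),
        finsum_mem_union (dis _ _ _) (hfin _ _ fin2) (hfin' _), finsum_mem_singleton_and,
        finsum_mem_singleton_and, hp, hq] at hrec
      -- The induction hypothesis contributes y with the sign opposite to ∂_i(x_p + x_q), so these
      -- terms cancel.
      rw [hrec]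
      split_ifs <;> first | (exfalso; omega) | ring
    · have hd : ¬ (y (i + 1) < y i ∧ y i ≠ i + 1) := by omega
      rw [if_neg hd, ascentConj_psiSigned_of_fixed (Or.inl rfl) hFZ _ h,
        ascentConj_psiSigned_of_fixed (Or.inr rfl) hFZ _ h, finsum_mem_empty]
      have h1 : (p : ℤ) = i ↔ (q : ℤ) = i + 1 := by
        constructor
        · intro h'
          rw [← hq, h', h]
        · intro h'
          apply y.injective
          rw [hq, h, h']
      have h2 : y (i + 1) = i := by rw [← h, apply_apply_of_mem_FZ hFZ]
      have n1 : (p : ℤ) ≠ i + 1 := fun h' => by rw [h', h2] at hq; omega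
      have n2 : (q : ℤ) ≠ i := fun h' => by rw [h', h] at hp; omega
      split_ifs <;> first | (exfalso; omega) | ring

end FPFSchubert

theorem theorem4 (y : Equiv.Perm ℤ) (hy : y ∈ FPFSchubert.FInf) (p q : ℕ+)
    (hpq : (p, q) ∈ FPFSchubert.cycP y) :
    (FPFSchubert.psiPlus y (q : ℤ)).Finite ∧ (FPFSchubert.psiMinus y (p : ℤ)).Finite ∧
      (MvPolynomial.X p + MvPolynomial.X q) * FPFSchubert.fpfSchubert y =
        (∑ᶠ z ∈ FPFSchubert.psiPlus y (q : ℤ), FPFSchubert.fpfSchubert z) -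
          (∑ᶠ z ∈ FPFSchubert.psiMinus y (p : ℤ), FPFSchubert.fpfSchubert z) := by
  have hFZ := (FPFSchubert.mem_FInf_iff.1 hy).1
  obtain ⟨hle, hq⟩ := hpq
  simp only at hle hq
  refine ⟨FPFSchubert.finite_psiPlus hFZ q, FPFSchubert.finite_psiMinus hFZ p, ?_⟩
  rw [FPFSchubert.psiPlus_eq hFZ, FPFSchubert.psiMinus_eq hFZ]
  refine FPFSchubert.transition_formula hy ?_ hq.symm
  -- p = q would be a fixed point of y.
  refine lt_of_le_of_ne (by exact_mod_cast hle) fun h => ?_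
  rw [h] at hq
  exact FPFSchubert.apply_ne_of_mem_FZ hFZ _ hq.symm
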